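/- **Problem AREC.** An instance consists of integers $1\le p\le n$ and $0\le k\le p$, a set $X\subseteq[n]$ of $p$ items (the first-stage solution), nominal costs $\underline c_i\ge 0$ and maximal deviations $d_i\ge 0$ for $i\in[n]$, and a budget $\Gamma\ge 0$. Put $\overline c_i=\underline c_i+d_i$. The scenario set is $$\mathcal U^c=\Big\{(\underline c_i+\delta_i)_{i\in[n]}:\ \delta_i\in[0,d_i]\ (i\in[n]),\ \sum_{i\in[n]}\delta_i\le\Gamma\Big\},$$ and the recovery set $\Phi$ consists of all $Y\subseteq[n]$ with $|Y|=p$ and $|X\cap Y|\ge p-k$. The problem is to find a scenario $c\in\mathcal U^c$ that maximizes $F(c)=\min_{Y\in\Phi}\sum_{i\in Y}c_i$. For real numbers $L,M$ (levels), a scenario $c$ is called $(L,M)$-compatible if $c_i=\max\{\underline c_i,\min\{\overline c_i,L\}\}$ for all $i\in X$ and $c_i=\max\{\underline c_i,\min\{\overline c_i,M\}\}$ for all $i\in[n]\setminus X$. The model of computation is the real RAM: a program works on finitely many variables and arrays of natural and real numbers; each arithmetic operation ($+,-,\times,/$ on reals; $+$, truncated subtraction and halving on natural numbers; conversion of a natural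 number into a real one), comparison, memory access, assignment and branch takes one unit of time. **Theorem.** Problem AREC under $\mathcal U^c$ can be solved in $O(n\log n)$ time. More precisely, there are one real RAM program and a function $T:\mathbb N\to\mathbb N$ with $T(n)=O(n\log n)$ such that, for every $n$, on every instance with $n$ items the program halts after at most $T(n)$ steps and returns an optimal scenario $c$, its objective value $F(c)$ (the optimal value of the instance), and two levels $L,M$ for which $c$ is $(L,M)$-compatible. -/

import Mathlib

open Filter Asymptotics

/-! ### The machine model: a real RAM

A program has finitely many variables holding natural numbers (indices, counters, pointers), finitely
many variables holding real numbers, and finitely many arrays of either kind, all named by natural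
numbers that are literals of the program. Every elementary operation (a literal, a variable access, an
array access, an arithmetic operation, a comparison, an assignment, a branch, a loop test) costs one
unit of time. There is no rounding of real numbers, no multiplication of natural numbers, and a
program contains no real constants other than those it computes from natural numbers. -/

namespace RealRAM

/-- Contents of the memory. -/
structure State where
  natVar : ℕ → ℕ
  realVar : ℕ → ℝ
  natArr : ℕ → ℕ → ℕ
  realArr : ℕ → ℕ → ℝ

/-- Expressions with a natural number as value. -/
inductive NatExpr where
  | lit (m : ℕ)
  | var (v : ℕ)
  | read (a : ℕ) (i : NatExpr)
  | plus (e f : NatExpr)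
  | minus (e f : NatExpr)
  | half (e : NatExpr)

/-- Expressions with a real number as value. -/
inductive RealExpr where
  | ofNat (e : NatExpr)
  | var (v : ℕ)
  | read (a : ℕ) (i : NatExpr)
  | plus (e f : RealExpr)
  | minus (e f : RealExpr)
  | times (e f : RealExpr)
  | divide (e f : RealExpr)

/-- Tests. -/
inductive Test where
  | natLt (e f : NatExpr)
  | realLt (e f : RealExpr)
  | neg (b : Test)
  | both (b c : Test)

/-- Programs. -/
inductive Program where
  | skip
  | setNat (v : ℕ) (e : NatExpr)
  | setReal (v : ℕ) (e : RealExpr)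
  | writeNat (a : ℕ) (i : NatExpr) (e : NatExpr)
  | writeReal (a : ℕ) (i : NatExpr) (e : RealExpr)
  | seq (P Q : Program)
  | cond (b : Test) (P Q : Program)
  | loop (b : Test) (P : Program)

/-- Value of an expression (subtraction is truncated at `0`, and `half` rounds down). -/
def NatExpr.eval (s : State) : NatExpr → ℕ
  | lit m => m
  | var v => s.natVar v
  | read a i => s.natArr a (i.eval s)
  | plus e f => e.eval s + f.eval s
  | minus e f => e.eval s - f.eval s
  | half e => e.eval s / 2

/-- Value of an expression (a quotient with denominator `0` is `0`). -/
noncomputable def RealExpr.eval (s : State) : RealExpr → ℝ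
  | ofNat e => (e.eval s : ℝ)
  | var v => s.realVar v
  | read a i => s.realArr a (i.eval s)
  | plus e f => e.eval s + f.eval s
  | minus e f => e.eval s - f.eval s
  | times e f => e.eval s * f.eval s
  | divide e f => e.eval s / f.eval s

/-- Truth of a test. -/
def Test.Holds (s : State) : Test → Prop
  | natLt e f => e.eval s < f.eval s
  | realLt e f => e.eval s < f.eval s
  | neg b => ¬ b.Holds s
  | both b c => b.Holds s ∧ c.Holds s

/-- Number of elementary operations that the evaluation takes. -/
def NatExpr.cost : NatExpr → ℕ
  | lit _ => 1
  | var _ => 1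
  | read _ i => i.cost + 1
  | plus e f => e.cost + f.cost + 1
  | minus e f => e.cost + f.cost + 1
  | half e => e.cost + 1

/-- Number of elementary operations that the evaluation takes. -/
def RealExpr.cost : RealExpr → ℕ
  | ofNat e => e.cost + 1
  | var _ => 1
  | read _ i => i.cost + 1
  | plus e f => e.cost + f.cost + 1
  | minus e f => e.cost + f.cost + 1
  | times e f => e.cost + f.cost + 1
  | divide e f => e.cost + f.cost + 1

/-- Number of elementary operations that the evaluation takes. -/
def Test.cost : Test → ℕ
  | natLt e f => e.cost + f.cost + 1
  | realLt e f => e.cost + f.cost + 1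
  | neg b => b.cost + 1
  | both b c => b.cost + c.cost + 1

/-- `Exec P s t s'`: started in the state `s`, the program `P` halts in the state `s'` after exactly
`t` elementary operations. -/
inductive Exec : Program → State → ℕ → State → Prop where
  | skip (s : State) : Exec .skip s 1 s
  | setNat (v : ℕ) (e : NatExpr) (s : State) :
      Exec (.setNat v e) s (e.cost + 1)
        { s with natVar := Function.update s.natVar v (e.eval s) }
  | setReal (v : ℕ) (e : RealExpr) (s : State) :
      Exec (.setReal v e) s (e.cost + 1)
        { s with realVar := Function.update s.realVar v (e.eval s) }
  | writeNat (a : ℕ) (i e : NatExpr) (s : State) :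
      Exec (.writeNat a i e) s (i.cost + e.cost + 1)
        { s with natArr :=
            Function.update s.natArr a (Function.update (s.natArr a) (i.eval s) (e.eval s)) }
  | writeReal (a : ℕ) (i : NatExpr) (e : RealExpr) (s : State) :
      Exec (.writeReal a i e) s (i.cost + e.cost + 1)
        { s with realArr :=
            Function.update s.realArr a (Function.update (s.realArr a) (i.eval s) (e.eval s)) }
  | seq {P Q : Program} {s₁ s₂ s₃ : State} {t₁ t₂ : ℕ} :
      Exec P s₁ t₁ s₂ → Exec Q s₂ t₂ s₃ → Exec (.seq P Q) s₁ (t₁ + t₂) s₃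
  | condTrue {b : Test} {P Q : Program} {s s' : State} {t : ℕ} :
      b.Holds s → Exec P s t s' → Exec (.cond b P Q) s (b.cost + 1 + t) s'
  | condFalse {b : Test} {P Q : Program} {s s' : State} {t : ℕ} :
      ¬ b.Holds s → Exec Q s t s' → Exec (.cond b P Q) s (b.cost + 1 + t) s'
  | loopDone {b : Test} {P : Program} {s : State} :
      ¬ b.Holds s → Exec (.loop b P) s (b.cost + 1) s
  | loopStep {b : Test} {P : Program} {s₁ s₂ s₃ : State} {t₁ t₂ : ℕ} :
      b.Holds s₁ → Exec P s₁ t₁ s₂ → Exec (.loop b P) s₂ t₂ s₃ →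
        Exec (.loop b P) s₁ (b.cost + 1 + t₁ + t₂) s₃

end RealRAM

/-! ### The adversarial recoverable selection problem under continuous budgeted uncertainty -/

/-- An instance with `n` items. The first-stage solution, a 0-1 vector with `p` ones, is given as the
set `X` of its items. -/
structure ARECInstance (n : ℕ) where
  /-- number of items to select -/
  p : ℕ
  /-- recovery parameter -/
  k : ℕ
  /-- first-stage solution -/
  X : Finset (Fin n)
  /-- nominal costs -/
  lo : Fin n → ℝ
  /-- maximal deviations of the costs -/
  d : Fin n → ℝ
  /-- budget of the adversary -/
  Γ : ℝ
  one_le_p : 1 ≤ p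
  p_le_n : p ≤ n
  k_le_p : k ≤ p
  card_X : X.card = p
  lo_nonneg : ∀ i, 0 ≤ lo i
  d_nonneg : ∀ i, 0 ≤ d i
  Γ_nonneg : 0 ≤ Γ

namespace ARECInstance

variable {n : ℕ}

/-- The upper bound of the cost of an item. -/
def hi (I : ARECInstance n) (i : Fin n) : ℝ := I.lo i + I.d i

/-- The continuous budgeted uncertainty set. -/
def scenarios (I : ARECInstance n) : Set (Fin n → ℝ) :=
  {c | ∃ δ : Fin n → ℝ, (∀ i, δ i ∈ Set.Icc 0 (I.d i)) ∧ ∑ i, δ i ≤ I.Γ ∧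
    ∀ i, c i = I.lo i + δ i}

/-- The recovery set: the sets of `p` items that share at least `p - k` items with `X`. -/
def recoverySet (I : ARECInstance n) : Finset (Finset (Fin n)) :=
  Finset.univ.filter fun Y => Y.card = I.p ∧ I.p - I.k ≤ (I.X ∩ Y).card

theorem recoverySet_nonempty (I : ARECInstance n) : I.recoverySet.Nonempty :=
  ⟨I.X, by simp [recoverySet, I.card_X]⟩

/-- The cheapest recovery cost under the scenario `c`. The problem is to maximize it over all
scenarios. -/
noncomputable def recoveryCost (I : ARECInstance n) (c : Fin n → ℝ) : ℝ :=
  I.recoverySet.inf' I.recoverySet_nonempty fun Y => ∑ i ∈ Y, c i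

/-- Optimal solutions of the problem. -/
def IsWorstScenario (I : ARECInstance n) (c : Fin n → ℝ) : Prop :=
  c ∈ I.scenarios ∧ ∀ c' ∈ I.scenarios, I.recoveryCost c' ≤ I.recoveryCost c

/-- `c` raises the items of `X` to the level `L` and all other items to the level `M`, as far as their
cost intervals permit. -/
def IsCompatible (I : ARECInstance n) (L M : ℝ) (c : Fin n → ℝ) : Prop :=
  (∀ i ∈ I.X, c i = max (I.lo i) (min (I.hi i) L)) ∧
    ∀ i ∉ I.X, c i = max (I.lo i) (min (I.hi i) M)

/-- The memory at the start: `n`, `p`, `k` in the natural variables `0`, `1`, `2`, the budget in the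
real variable `0`, the 0-1 vector of `X` in the natural array `0`, the nominal costs and the maximal
deviations in the real arrays `0` and `1`, and `0` everywhere else. -/
noncomputable def input (I : ARECInstance n) : RealRAM.State where
  natVar v := if v = 0 then n else if v = 1 then I.p else if v = 2 then I.k else 0
  realVar v := if v = 0 then I.Γ else 0
  natArr a j := if h : j < n then (if a = 0 ∧ ⟨j, h⟩ ∈ I.X then 1 else 0) else 0
  realArr a j :=
    if h : j < n then (if a = 0 then I.lo ⟨j, h⟩ else if a = 1 then I.d ⟨j, h⟩ else 0) else 0

end ARECInstance

/-- The scenario that a program returns, in the first `n` entries of the real array `2`. -/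
def RealRAM.State.scenario (s : RealRAM.State) (n : ℕ) : Fin n → ℝ := fun i => s.realArr 2 i

/-!
The problem is a maximization of a minimum, which linear programming duality turns into a maximization.
For costs `c`, the cheapest recovery action is found by a greedy choice, and the thresholds `u` for the
items of `X` and `v ≤ u` for the other items that separate the chosen items from the rest are optimal dual
multipliers: `recoveryCost c` is the largest value over `v ≤ u` of

  `dual c u v = (p - k) u + k v - ∑ i ∈ X, (u - c i)⁺ - ∑ i ∉ X, (v - c i)⁺`

(`dual_le_recoveryCost`, `exists_recoveryCost_le_dual`). For fixed multipliers, each unit of the budget that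
raises an item below its threshold gains one unit, so the best scenario has the value

  `bound u v = min (Γ + dual lo u v) (dual hi u v)`,

and the optimal value is the maximum of `bound` over `v ≤ u`. From optimal multipliers one gets a worst
scenario by raising the items to levels `L ≤ u` and `M ≤ v` that use up as much of the budget as `u` and `v`
would, but at most `Γ` (`isWorstScenario_of_levels`).

Both functions in `bound` are sums of a concave function of `u` and one of `v` that are affine between
consecutive cost bounds. Inside a cell of the grid of these bounds, two linear functionals have a common
direction of nondecrease; hence some optimal pair has `u` on the grid, or `v` on the grid, or `u = v`
(`exists_le_of_grid`). In each case one variable is left, and the minimum of two concave functions of one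
variable is largest where they cross, unless the crossing lies outside of the interval between their
maximizers, in which case the nearest maximizer is best (`Crossing.min_le`).

The program sorts the `2 n` cost bounds by bottom-up merge sort (`runs_mergeSort`), tabulates the four
concave functions, and finds for each grid point, as `u` and as `v`, the best partner by bisection in the
tables (`runs_searchOut`, `runs_searchIn`). Running times are derived together with correctness in a Hoare
logic (`Runs`); the variables and arrays that a piece of the program leaves alone are read off its text
(`Frame`).
-/

/-! ### Reasoning about programs -/

namespace RealRAM

attribute [simp] NatExpr.eval RealExpr.eval Test.Holds NatExpr.cost RealExpr.cost Test.cost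

/-- The state after an assignment to a natural variable. -/
def State.setNat (s : State) (v x : ℕ) : State :=
  { s with natVar := Function.update s.natVar v x }

/-- The state after an assignment to a real variable. -/
def State.setReal (s : State) (v : ℕ) (x : ℝ) : State :=
  { s with realVar := Function.update s.realVar v x }

/-- The state after an assignment to an entry of a natural array. -/
def State.writeNat (s : State) (a i x : ℕ) : State :=
  { s with natArr := Function.update s.natArr a (Function.update (s.natArr a) i x) }

/-- The state after an assignment to an entry of a real array. -/
def State.writeReal (s : State) (a i : ℕ) (x : ℝ) : State :=
  { s with realArr := Function.update s.realArr a (Function.update (s.realArr a) i x) }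

section StateLemmas
variable (s : State) (v w a b i : ℕ) (x : ℕ) (y : ℝ)

@[simp] theorem State.setNat_natVar :
    (s.setNat v x).natVar w = if w = v then x else s.natVar w := by
  simp [State.setNat, Function.update_apply]
@[simp] theorem State.setNat_realVar : (s.setNat v x).realVar = s.realVar := rfl
@[simp] theorem State.setNat_natArr : (s.setNat v x).natArr = s.natArr := rfl
@[simp] theorem State.setNat_realArr : (s.setNat v x).realArr = s.realArr := rfl

@[simp] theorem State.setReal_realVar :
    (s.setReal v y).realVar w = if w = v then y else s.realVar w := by
  simp [State.setReal, Function.update_apply]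
@[simp] theorem State.setReal_natVar : (s.setReal v y).natVar = s.natVar := rfl
@[simp] theorem State.setReal_natArr : (s.setReal v y).natArr = s.natArr := rfl
@[simp] theorem State.setReal_realArr : (s.setReal v y).realArr = s.realArr := rfl

@[simp] theorem State.writeNat_natArr : (s.writeNat a i x).natArr b =
    if b = a then Function.update (s.natArr a) i x else s.natArr b := by
  simp [State.writeNat, Function.update_apply]
@[simp] theorem State.writeNat_natVar : (s.writeNat a i x).natVar = s.natVar := rfl
@[simp] theorem State.writeNat_realVar : (s.writeNat a i x).realVar = s.realVar := rfl
@[simp] theorem State.writeNat_realArr : (s.writeNat a i x).realArr = s.realArr := rfl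

@[simp] theorem State.writeReal_realArr : (s.writeReal a i y).realArr b =
    if b = a then Function.update (s.realArr a) i y else s.realArr b := by
  simp [State.writeReal, Function.update_apply]
@[simp] theorem State.writeReal_natVar : (s.writeReal a i y).natVar = s.natVar := rfl
@[simp] theorem State.writeReal_realVar : (s.writeReal a i y).realVar = s.realVar := rfl
@[simp] theorem State.writeReal_natArr : (s.writeReal a i y).natArr = s.natArr := rfl

end StateLemmas

/-- Total correctness with a clock: started in `s`, the program `P` halts, and its running time and
final state satisfy `Q`. -/
def Runs (P : Program) (s : State) (Q : ℕ → State → Prop) : Prop :=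
  ∃ t s', Exec P s t s' ∧ Q t s'

section RunsLemmas
variable {s : State} {Q R : ℕ → State → Prop} {P P' : Program} {b : Test}

theorem Runs.mono (h : Runs P s Q) (hQ : ∀ t s', Q t s' → R t s') : Runs P s R := by
  obtain ⟨t, s', h, q⟩ := h
  exact ⟨t, s', h, hQ _ _ q⟩

@[simp] theorem runs_skip : Runs .skip s Q ↔ Q 1 s :=
  ⟨by rintro ⟨t, s', h, q⟩; cases h; exact q, fun h => ⟨_, _, .skip _, h⟩⟩

@[simp] theorem runs_setNat {v : ℕ} {e : NatExpr} :
    Runs (.setNat v e) s Q ↔ Q (e.cost + 1) (s.setNat v (e.eval s)) :=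
  ⟨by rintro ⟨t, s', h, q⟩; cases h; exact q, fun h => ⟨_, _, .setNat _ _ _, h⟩⟩

@[simp] theorem runs_setReal {v : ℕ} {e : RealExpr} :
    Runs (.setReal v e) s Q ↔ Q (e.cost + 1) (s.setReal v (e.eval s)) :=
  ⟨by rintro ⟨t, s', h, q⟩; cases h; exact q, fun h => ⟨_, _, .setReal _ _ _, h⟩⟩

@[simp] theorem runs_writeNat {a : ℕ} {i e : NatExpr} :
    Runs (.writeNat a i e) s Q ↔
      Q (i.cost + e.cost + 1) (s.writeNat a (i.eval s) (e.eval s)) :=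
  ⟨by rintro ⟨t, s', h, q⟩; cases h; exact q, fun h => ⟨_, _, .writeNat _ _ _ _, h⟩⟩

@[simp] theorem runs_writeReal {a : ℕ} {i : NatExpr} {e : RealExpr} :
    Runs (.writeReal a i e) s Q ↔
      Q (i.cost + e.cost + 1) (s.writeReal a (i.eval s) (e.eval s)) :=
  ⟨by rintro ⟨t, s', h, q⟩; cases h; exact q, fun h => ⟨_, _, .writeReal _ _ _ _, h⟩⟩

@[simp] theorem runs_seq :
    Runs (.seq P P') s Q ↔
      Runs P s fun t s' => Runs P' s' fun t' s'' => Q (t + t') s'' := by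
  constructor
  · rintro ⟨t, s', h, q⟩
    cases h with
    | seq h₁ h₂ => exact ⟨_, _, h₁, _, _, h₂, q⟩
  · rintro ⟨t, s', h₁, t', s'', h₂, q⟩
    exact ⟨_, _, .seq h₁ h₂, q⟩

@[simp] theorem runs_cond :
    Runs (.cond b P P') s Q ↔
      (b.Holds s → Runs P s fun t s' => Q (b.cost + 1 + t) s') ∧
      (¬ b.Holds s → Runs P' s fun t s' => Q (b.cost + 1 + t) s') := by
  constructor
  · rintro ⟨t, s', h, q⟩
    cases h with
    | condTrue hb h => exact ⟨fun _ => ⟨_, _, h, q⟩, fun hn => absurd hb hn⟩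
    | condFalse hb h => exact ⟨fun hp => absurd hp hb, fun _ => ⟨_, _, h, q⟩⟩
  · rintro ⟨h₁, h₂⟩
    by_cases hb : b.Holds s
    · obtain ⟨t, s', h, q⟩ := h₁ hb
      exact ⟨_, _, .condTrue hb h, q⟩
    · obtain ⟨t, s', h, q⟩ := h₂ hb
      exact ⟨_, _, .condFalse hb h, q⟩

end RunsLemmas

namespace Program

/-- Whether some assignment in the program has the natural variable `v` as target. -/
def setsNat (v : ℕ) : Program → Bool
  | setNat w _ => w == v
  | seq P Q => P.setsNat v || Q.setsNat v
  | cond _ P Q => P.setsNat v || Q.setsNat v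
  | loop _ P => P.setsNat v
  | _ => false

/-- Whether some assignment in the program has the real variable `v` as target. -/
def setsReal (v : ℕ) : Program → Bool
  | setReal w _ => w == v
  | seq P Q => P.setsReal v || Q.setsReal v
  | cond _ P Q => P.setsReal v || Q.setsReal v
  | loop _ P => P.setsReal v
  | _ => false

/-- Whether some assignment in the program has an entry of the natural array `a` as target. -/
def writesNat (a : ℕ) : Program → Bool
  | writeNat b _ _ => b == a
  | seq P Q => P.writesNat a || Q.writesNat a
  | cond _ P Q => P.writesNat a || Q.writesNat a
  | loop _ P => P.writesNat a
  | _ => false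

/-- Whether some assignment in the program has an entry of the real array `a` as target. -/
def writesReal (a : ℕ) : Program → Bool
  | writeReal b _ _ => b == a
  | seq P Q => P.writesReal a || Q.writesReal a
  | cond _ P Q => P.writesReal a || Q.writesReal a
  | loop _ P => P.writesReal a
  | _ => false

end Program

/-- The states `s` and `s'` agree on all variables and arrays to which `P` assigns nothing. -/
structure Frame (P : Program) (s s' : State) : Prop where
  natVar : ∀ v, P.setsNat v = false → s'.natVar v = s.natVar v
  realVar : ∀ v, P.setsReal v = false → s'.realVar v = s.realVar v
  natArr : ∀ a, P.writesNat a = false → s'.natArr a = s.natArr a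
  realArr : ∀ a, P.writesReal a = false → s'.realArr a = s.realArr a

theorem Frame.refl (P : Program) (s : State) : Frame P s s :=
  ⟨fun _ _ => rfl, fun _ _ => rfl, fun _ _ => rfl, fun _ _ => rfl⟩

theorem Frame.trans {P : Program} {s₁ s₂ s₃ : State} (h : Frame P s₁ s₂) (h' : Frame P s₂ s₃) :
    Frame P s₁ s₃ :=
  ⟨fun v hv => (h'.natVar v hv).trans (h.natVar v hv),
    fun v hv => (h'.realVar v hv).trans (h.realVar v hv),
    fun a ha => (h'.natArr a ha).trans (h.natArr a ha),
    fun a ha => (h'.realArr a ha).trans (h.realArr a ha)⟩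

/-- Fewer assignments leave more unchanged. -/
theorem Frame.weaken {P P' : Program} {s s' : State} (h : Frame P s s')
    (h₁ : ∀ v, P'.setsNat v = false → P.setsNat v = false)
    (h₂ : ∀ v, P'.setsReal v = false → P.setsReal v = false)
    (h₃ : ∀ v, P'.writesNat v = false → P.writesNat v = false)
    (h₄ : ∀ v, P'.writesReal v = false → P.writesReal v = false) : Frame P' s s' :=
  ⟨fun v hv => h.natVar v (h₁ v hv), fun v hv => h.realVar v (h₂ v hv),
    fun a ha => h.natArr a (h₃ a ha), fun a ha => h.realArr a (h₄ a ha)⟩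

theorem Exec.frame {P : Program} {s s' : State} {t : ℕ} (h : Exec P s t s') : Frame P s s' := by
  induction h with
  | skip s => exact .refl _ _
  | setNat v e s =>
    refine ⟨fun w hw => ?_, fun _ _ => rfl, fun _ _ => rfl, fun _ _ => rfl⟩
    exact Function.update_of_ne (by rintro rfl; simp [Program.setsNat] at hw) _ _
  | setReal v e s =>
    refine ⟨fun _ _ => rfl, fun w hw => ?_, fun _ _ => rfl, fun _ _ => rfl⟩
    exact Function.update_of_ne (by rintro rfl; simp [Program.setsReal] at hw) _ _
  | writeNat a i e s =>
    refine ⟨fun _ _ => rfl, fun _ _ => rfl, fun w hw => ?_, fun _ _ => rfl⟩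
    exact Function.update_of_ne (by rintro rfl; simp [Program.writesNat] at hw) _ _
  | writeReal a i e s =>
    refine ⟨fun _ _ => rfl, fun _ _ => rfl, fun _ _ => rfl, fun w hw => ?_⟩
    exact Function.update_of_ne (by rintro rfl; simp [Program.writesReal] at hw) _ _
  | seq _ _ ih₁ ih₂ =>
    refine (ih₁.weaken ?_ ?_ ?_ ?_).trans (ih₂.weaken ?_ ?_ ?_ ?_) <;>
      simp +contextual [Program.setsNat, Program.setsReal, Program.writesNat, Program.writesReal]
  | condTrue _ _ ih =>
    refine ih.weaken ?_ ?_ ?_ ?_ <;>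
      simp +contextual [Program.setsNat, Program.setsReal, Program.writesNat, Program.writesReal]
  | condFalse _ _ ih =>
    refine ih.weaken ?_ ?_ ?_ ?_ <;>
      simp +contextual [Program.setsNat, Program.setsReal, Program.writesNat, Program.writesReal]
  | loopDone _ => exact .refl _ _
  | loopStep _ _ _ ih₁ ih₂ =>
    exact (ih₁.weaken (P' := .loop _ _) (fun _ h => h) (fun _ h => h) (fun _ h => h)
      (fun _ h => h)).trans ih₂

theorem Runs.frame {P : Program} {s : State} {Q : ℕ → State → Prop} (h : Runs P s Q) :
    Runs P s fun t s' => Q t s' ∧ Frame P s s' := by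
  obtain ⟨t, s', h, q⟩ := h
  exact ⟨t, s', h, q, h.frame⟩

/-- The rule for loops: the invariant `J m` holds while at most `m` iterations remain, and each
iteration takes at most `B` steps. -/
theorem Runs.loop {b : Test} {P : Program} (J : ℕ → State → Prop) {B m : ℕ} {s : State}
    (hs : J m s) (h0 : ∀ s', J 0 s' → ¬ b.Holds s')
    (hstep : ∀ m s', Frame P s s' → J (m + 1) s' → b.Holds s' →
      Runs P s' fun t s'' => t ≤ B ∧ J m s'') :
    Runs (.loop b P) s fun t s' =>
      t ≤ m * (B + b.cost + 1) + b.cost + 1 ∧ (∃ m, J m s') ∧ ¬ b.Holds s' := by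
  suffices H : ∀ s₁, J m s₁ → Frame P s s₁ → Runs (.loop b P) s₁ fun t s' =>
      t ≤ m * (B + b.cost + 1) + b.cost + 1 ∧ (∃ m, J m s') ∧ ¬ b.Holds s' from
    H s hs (.refl _ _)
  clear hs
  induction m with
  | zero =>
    intro s₁ hs _
    exact ⟨_, _, .loopDone (h0 s₁ hs), by simp, ⟨0, hs⟩, h0 s₁ hs⟩
  | succ m ih =>
    intro s₁ hs hf
    by_cases hb : b.Holds s₁
    · obtain ⟨t₁, s₂, he₁, ht₁, hs₂⟩ := hstep m s₁ hf hs hb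
      obtain ⟨t₂, s₃, he₂, ht₂, hs₃⟩ := ih s₂ hs₂ (hf.trans he₁.frame)
      refine ⟨_, _, .loopStep hb he₁ he₂, ?_, hs₃⟩
      have : (m + 1) * (B + b.cost + 1) = m * (B + b.cost + 1) + (B + b.cost + 1) := by ring
      omega
    · refine ⟨_, _, .loopDone hb, ?_, ⟨m + 1, hs⟩, hb⟩
      have := Nat.zero_le ((m + 1) * (B + b.cost + 1))
      omega

/-- The loop `for v = 0, …, w - 1 do P`, where `w` is a natural variable. -/
def Program.forLoop (v w : ℕ) (P : Program) : Program :=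
  .seq (.setNat v (.lit 0))
    (.loop (.natLt (.var v) (.var w)) (.seq P (.setNat v (.plus (.var v) (.lit 1)))))

theorem Runs.forLoop {v w : ℕ} {P : Program} (J : ℕ → State → Prop) {B : ℕ} {s : State}
    (hv : P.setsNat v = false) (hw : P.setsNat w = false) (hvw : v ≠ w)
    (h0 : J 0 (s.setNat v 0))
    (hstep : ∀ i s', i < s.natVar w → s'.natVar v = i → Frame (.forLoop v w P) s s' → J i s' →
      Runs P s' fun t s'' => t ≤ B ∧ J (i + 1) (s''.setNat v (i + 1))) :
    Runs (.forLoop v w P) s fun t s' =>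
      t ≤ s.natVar w * (B + 8) + 8 ∧ J (s.natVar w) s' ∧ Frame (.forLoop v w P) s s' := by
  have hF : Frame (.forLoop v w P) s (s.setNat v 0) :=
    ⟨fun u hu => by
        have : u ≠ v := by rintro rfl; simp [Program.forLoop, Program.setsNat] at hu
        simp [this], fun _ _ => rfl, fun _ _ => rfl, fun _ _ => rfl⟩
  have hf' {s₁ s₂ : State} (h : Frame (.seq P (.setNat v (.plus (.var v) (.lit 1)))) s₁ s₂) :
      Frame (.forLoop v w P) s₁ s₂ := by
    refine h.weaken ?_ ?_ ?_ ?_ <;>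
      simp +contextual [Program.forLoop, Program.setsNat, Program.setsReal, Program.writesNat,
        Program.writesReal]
  have key : Runs (.loop (.natLt (.var v) (.var w)) (.seq P (.setNat v (.plus (.var v) (.lit 1)))))
      (s.setNat v 0) fun t s' => t ≤ s.natVar w * (B + 4 + 3 + 1) + 3 + 1 ∧
        (∃ m, m + s'.natVar v = s.natVar w ∧ s'.natVar w = s.natVar w ∧ J (s'.natVar v) s') ∧
        ¬ (Test.natLt (.var v) (.var w)).Holds s' := by
    refine Runs.loop
      (fun m s' => m + s'.natVar v = s.natVar w ∧ s'.natVar w = s.natVar w ∧ J (s'.natVar v) s')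
      (B := B + 4) (m := s.natVar w) (s := s.setNat v 0)
      ⟨by simp, by simp [Ne.symm hvw], by simpa using h0⟩ ?_ ?_
    · rintro s' ⟨h₁, h₂, -⟩
      simp; omega
    · rintro m s' hf ⟨h₁, h₂, h₃⟩ hb
      rw [runs_seq]
      refine (Runs.frame (hstep (s'.natVar v) s' (by omega) rfl (hF.trans (hf' hf)) h₃)).mono ?_
      rintro t s'' ⟨⟨ht, hJ⟩, hf'⟩
      have e₁ := hf'.natVar v hv
      have e₂ := hf'.natVar w hw
      simp only [runs_setNat, NatExpr.cost, NatExpr.eval]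
      refine ⟨by omega, ?_⟩
      rw [e₁]
      simp only [State.setNat_natVar, if_true, if_neg (Ne.symm hvw)]
      exact ⟨by omega, by omega, hJ⟩
  rw [Program.forLoop, runs_seq, runs_setNat]
  refine key.frame.mono ?_
  rintro t s' ⟨⟨ht, ⟨m, h₁, h₂, h₃⟩, hb⟩, hf⟩
  simp only [Test.Holds, NatExpr.eval] at hb
  have e : s'.natVar v = s.natVar w := by omega
  refine ⟨?_, e ▸ h₃, hF.trans (hf' (hf.weaken ?_ ?_ ?_ ?_))⟩
  · rw [show B + 4 + 3 + 1 = B + 8 from rfl] at ht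
    simp only [NatExpr.cost]
    omega
  all_goals simp [Program.setsNat, Program.setsReal, Program.writesNat, Program.writesReal]

end RealRAM

/-! ### Duality for the recovery problem -/

/-- The concave piecewise linear function `u ↦ κ u - ∑ i ∈ S, (u - x i)⁺`. -/
def bend {ι : Type*} (S : Finset ι) (κ : ℝ) (x : ι → ℝ) (u : ℝ) : ℝ :=
  κ * u - ∑ i ∈ S, max 0 (u - x i)

section Bend
variable {ι : Type*} {S : Finset ι} {κ : ℝ} {x y : ι → ℝ}

theorem bend_mono_right (h : ∀ i ∈ S, x i ≤ y i) (u : ℝ) : bend S κ x u ≤ bend S κ y u := by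
  unfold bend
  gcongr with i hi
  exact h i hi

theorem concaveOn_bend : ConcaveOn ℝ Set.univ (bend S κ x) := by
  refine ⟨convex_univ, fun a _ c _ s r hs hr hsr => ?_⟩
  have : ∑ i ∈ S, max 0 (s * a + r * c - x i) ≤
      s * ∑ i ∈ S, max 0 (a - x i) + r * ∑ i ∈ S, max 0 (c - x i) := by
    rw [Finset.mul_sum, Finset.mul_sum, ← Finset.sum_add_distrib]
    refine Finset.sum_le_sum fun i _ => max_le ?_ ?_
    · exact add_nonneg (mul_nonneg hs (le_max_left _ _)) (mul_nonneg hr (le_max_left _ _))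
    · have h₁ := mul_le_mul_of_nonneg_left (le_max_right 0 (a - x i)) hs
      have h₂ := mul_le_mul_of_nonneg_left (le_max_right 0 (c - x i)) hr
      have h₃ : x i = (s + r) * x i := by rw [hsr, one_mul]
      linarith
  unfold bend
  simp only [smul_eq_mul]
  linarith

/-- Between two breakpoints the function is affine. -/
theorem exists_bend_eq {a b : ℝ} (h : ∀ i ∈ S, x i ≤ a ∨ b ≤ x i) :
    ∃ m, ∀ u, a ≤ u → u ≤ b → bend S κ x u = bend S κ x a + m * (u - a) := by
  classical
  refine ⟨κ - ∑ i ∈ S, if x i ≤ a then 1 else 0, fun u hau hub => ?_⟩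
  have : ∑ i ∈ S, max 0 (u - x i) =
      ∑ i ∈ S, max 0 (a - x i) + (∑ i ∈ S, if x i ≤ a then 1 else 0) * (u - a) := by
    rw [Finset.sum_mul, ← Finset.sum_add_distrib]
    refine Finset.sum_congr rfl fun i hi => ?_
    split_ifs with hx
    · rw [max_eq_right (by linarith), max_eq_right (by linarith)]; ring
    · have := (h i hi).resolve_left hx
      rw [max_eq_left (by linarith), max_eq_left (by linarith)]; ring
  unfold bend
  rw [this]
  ring

/-- The price for raising the breakpoints from `x` to `y` grows with `u`. -/
theorem bend_sub_mono (h : ∀ i ∈ S, x i ≤ y i) {u v : ℝ} (huv : u ≤ v) :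
    bend S κ y u - bend S κ x u ≤ bend S κ y v - bend S κ x v := by
  have : ∑ i ∈ S, (max 0 (u - x i) - max 0 (u - y i)) ≤
      ∑ i ∈ S, (max 0 (v - x i) - max 0 (v - y i)) := by
    refine Finset.sum_le_sum fun i hi => ?_
    have := h i hi
    rcases max_cases 0 (u - x i) with ⟨h₁, _⟩ | ⟨h₁, _⟩ <;>
    rcases max_cases 0 (u - y i) with ⟨h₂, _⟩ | ⟨h₂, _⟩ <;>
    rcases max_cases 0 (v - x i) with ⟨h₃, _⟩ | ⟨h₃, _⟩ <;>
    rcases max_cases 0 (v - y i) with ⟨h₄, _⟩ | ⟨h₄, _⟩ <;>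
    rw [h₁, h₂, h₃, h₄] <;> linarith
  unfold bend
  simp only [Finset.sum_sub_distrib] at this
  linarith

end Bend

namespace ARECInstance

variable {n : ℕ} (I : ARECInstance n)

theorem lo_le_hi (i : Fin n) : I.lo i ≤ I.hi i := by
  have := I.d_nonneg i
  unfold hi
  linarith

/-- The contribution of the items of `X` to the dual objective of the recovery problem. -/
noncomputable def dualIn (c : Fin n → ℝ) (u : ℝ) : ℝ := bend I.X (I.p - I.k) c u

/-- The contribution of the items outside `X` to the dual objective of the recovery problem. -/
noncomputable def dualOut (c : Fin n → ℝ) (v : ℝ) : ℝ := bend I.Xᶜ I.k c v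

/-- The dual objective of the recovery problem for the costs `c`: the multiplier `u` is the price of an
item of `X` and `v` that of an item outside `X`. -/
noncomputable def dual (c : Fin n → ℝ) (u v : ℝ) : ℝ := I.dualIn c u + I.dualOut c v

theorem dual_le_recoveryCost (c : Fin n → ℝ) {u v : ℝ} (h : v ≤ u) :
    I.dual c u v ≤ I.recoveryCost c := by
  refine Finset.le_inf' _ _ fun Y hY => ?_
  simp only [recoverySet, Finset.mem_filter, Finset.mem_univ, true_and] at hY
  obtain ⟨hp, hk⟩ := hY
  have hsplit (f : Fin n → ℝ) : ∑ i ∈ Y, f i = ∑ i ∈ I.X ∩ Y, f i + ∑ i ∈ I.Xᶜ ∩ Y, f i := by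
    rw [← Finset.sum_union]
    · congr 1; ext i; by_cases i ∈ I.X <;> simp [*]
    · rw [Finset.disjoint_left]; simp +contextual
  have hcard : ((I.X ∩ Y).card : ℝ) + (I.Xᶜ ∩ Y).card = I.p := by
    have := hsplit fun _ => 1
    simp only [Finset.sum_const, nsmul_eq_mul, mul_one] at this
    rw [← this, hp]
  have hk' : (I.p : ℝ) - I.k ≤ (I.X ∩ Y).card := by
    have : I.p ≤ (I.X ∩ Y).card + I.k := by omega
    have : (I.p : ℝ) ≤ (I.X ∩ Y).card + I.k := by exact_mod_cast this
    linarith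
  have hpart (S : Finset (Fin n)) (w : ℝ) :
      (S ∩ Y).card * w - ∑ i ∈ S, max 0 (w - c i) ≤ ∑ i ∈ S ∩ Y, c i := by
    have h₁ : ∑ i ∈ S ∩ Y, (w - c i) ≤ ∑ i ∈ S ∩ Y, max 0 (w - c i) :=
      Finset.sum_le_sum fun i _ => le_max_right _ _
    have h₂ : ∑ i ∈ S ∩ Y, max 0 (w - c i) ≤ ∑ i ∈ S, max 0 (w - c i) :=
      Finset.sum_le_sum_of_subset_of_nonneg Finset.inter_subset_left
        fun i _ _ => le_max_left _ _
    simp only [Finset.sum_sub_distrib, Finset.sum_const, nsmul_eq_mul] at h₁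
    linarith
  have h₁ := hpart I.X u
  have h₂ := hpart I.Xᶜ v
  rw [hsplit c]
  have h₃ := mul_nonneg (sub_nonneg.2 hk') (sub_nonneg.2 h)
  have h₄ : ((I.Xᶜ ∩ Y).card : ℝ) = I.p - (I.X ∩ Y).card := by linarith
  rw [h₄] at h₂
  unfold dual dualIn dualOut bend
  linarith

/-- A least upper bound above `a` of finitely many values. -/
theorem exists_level {ι : Type*} (S : Finset ι) (c : ι → ℝ) (a : ℝ) :
    ∃ w, a ≤ w ∧ (∀ i ∈ S, c i ≤ w) ∧ ∀ b, a ≤ b → (∀ i ∈ S, c i ≤ b) → w ≤ b := by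
  classical
  induction S using Finset.induction with
  | empty => exact ⟨a, le_rfl, by simp, fun b hb _ => hb⟩
  | insert i S _ ih =>
    obtain ⟨w, h₁, h₂, h₃⟩ := ih
    refine ⟨max w (c i), h₁.trans (le_max_left _ _), ?_, fun b hb hS => ?_⟩
    · simp only [Finset.mem_insert, forall_eq_or_imp]
      exact ⟨le_max_right _ _, fun j hj => (h₂ j hj).trans (le_max_left _ _)⟩
    · exact max_le (h₃ b hb fun j hj => hS j (Finset.mem_insert_of_mem hj))
        (hS i (Finset.mem_insert_self _ _))

/-- The duality gap is zero. The multipliers are thresholds that separate the items of a cheapest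
recovery action from the others, so they lie in every interval that contains all costs. -/
theorem exists_recoveryCost_le_dual (c : Fin n → ℝ) {a b : ℝ} (hab : a ≤ b) (ha : ∀ i, a ≤ c i)
    (hb : ∀ i, c i ≤ b) :
    ∃ u v, v ≤ u ∧ a ≤ v ∧ u ≤ b ∧ I.recoveryCost c ≤ I.dual c u v := by
  classical
  obtain ⟨Y, hY, hopt⟩ := I.recoverySet.exists_min_image (fun Y => ∑ i ∈ Y, c i)
    I.recoverySet_nonempty
  have hYY := hY
  simp only [recoverySet, Finset.mem_filter, Finset.mem_univ, true_and] at hY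
  obtain ⟨hp, hk⟩ := hY
  have hle : I.recoveryCost c ≤ ∑ i ∈ Y, c i := Finset.inf'_le _ hYY
  have hcard : (I.X ∩ Y).card + (I.Xᶜ ∩ Y).card = I.p := by
    rw [← hp, ← Finset.card_union_of_disjoint]
    · congr 1; ext i; by_cases i ∈ I.X <;> simp [*]
    · rw [Finset.disjoint_left]; simp +contextual
  -- exchanging one item of `Y` for another one
  have hexch (i j : Fin n) (hi : i ∈ Y) (hj : j ∉ Y)
      (h : I.p - I.k ≤ (I.X ∩ insert j (Y.erase i)).card) : c i ≤ c j := by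
    have hj' : j ∉ Y.erase i := fun h => hj (Finset.mem_of_mem_erase h)
    have h₁ := hopt (insert j (Y.erase i)) (by
      simp only [recoverySet, Finset.mem_filter, Finset.mem_univ, true_and]
      refine ⟨?_, h⟩
      rw [Finset.card_insert_of_notMem hj', Finset.card_erase_of_mem hi, hp]
      have := I.one_le_p
      omega)
    rw [Finset.sum_insert hj', ← Finset.add_sum_erase Y c hi] at h₁
    linarith
  have hsub (i j : Fin n) : (I.X ∩ Y).card ≤ (I.X ∩ insert j (Y.erase i)).card + 1 := by
    refine (Finset.card_le_card (t := insert i (I.X ∩ insert j (Y.erase i))) ?_).trans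
      (Finset.card_insert_le _ _)
    intro x hx
    simp only [Finset.mem_inter, Finset.mem_insert, Finset.mem_erase] at hx ⊢
    by_cases x = i <;> simp_all
  have hsub' (i j : Fin n) (hi : i ∉ I.X) : (I.X ∩ Y).card ≤ (I.X ∩ insert j (Y.erase i)).card := by
    refine Finset.card_le_card fun x hx => ?_
    simp only [Finset.mem_inter, Finset.mem_insert, Finset.mem_erase] at hx ⊢
    refine ⟨hx.1, Or.inr ⟨?_, hx.2⟩⟩
    rintro rfl
    exact hi hx.1
  have hsub'' (i j : Fin n) (hi : i ∈ Y) (hj : j ∉ Y) (hjX : j ∈ I.X) :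
      (I.X ∩ Y).card ≤ (I.X ∩ insert j (Y.erase i)).card := by
    have : (I.X ∩ Y).card + 1 ≤ (I.X ∩ insert j (Y.erase i)).card + 1 := by
      rw [← Finset.card_insert_of_notMem (s := I.X ∩ Y) (a := j) (by simp [hj])]
      refine (Finset.card_le_card (t := insert i (I.X ∩ insert j (Y.erase i))) ?_).trans
        (Finset.card_insert_le _ _)
      intro x hx
      simp only [Finset.mem_inter, Finset.mem_insert, Finset.mem_erase] at hx ⊢
      by_cases x = i <;> by_cases x = j <;> simp_all
    omega
  -- thresholds that separate `Y` from the other items certify its optimality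
  have hfin (S : Finset (Fin n)) (w : ℝ) (h₁ : ∀ i ∈ S ∩ Y, c i ≤ w)
      (h₂ : ∀ i ∈ S, i ∉ Y → w ≤ c i) :
      ∑ i ∈ S ∩ Y, c i = (S ∩ Y).card * w - ∑ i ∈ S, max 0 (w - c i) := by
    have e : ∑ i ∈ S, max 0 (w - c i) = ∑ i ∈ S ∩ Y, (w - c i) := by
      rw [← Finset.sum_subset Finset.inter_subset_left (f := fun i => max 0 (w - c i))
        (s₁ := S ∩ Y) (s₂ := S)]
      · refine Finset.sum_congr rfl fun i hi => max_eq_right ?_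
        linarith [h₁ i hi]
      · intro i hi hi'
        refine max_eq_left ?_
        have := h₂ i hi fun h => hi' (Finset.mem_inter.2 ⟨hi, h⟩)
        linarith
    rw [e]
    simp only [Finset.sum_sub_distrib, Finset.sum_const, nsmul_eq_mul]
    ring
  have hsum : ∑ i ∈ Y, c i = ∑ i ∈ I.X ∩ Y, c i + ∑ i ∈ I.Xᶜ ∩ Y, c i := by
    rw [← Finset.sum_union]
    · congr 1; ext i; by_cases i ∈ I.X <;> simp [*]
    · rw [Finset.disjoint_left]; simp +contextual
  have hcard' : ((I.X ∩ Y).card : ℝ) + (I.Xᶜ ∩ Y).card = I.p := by exact_mod_cast hcard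
  rcases eq_or_lt_of_le hk with hk' | hk'
  · obtain ⟨v, hv₁, hv₂, hv₃⟩ := exists_level (I.Xᶜ ∩ Y) c a
    obtain ⟨u, hu₁, hu₂, hu₃⟩ := exists_level (I.X ∩ Y) c v
    have hvb : v ≤ b := hv₃ b hab fun i _ => hb i
    refine ⟨u, v, hu₁, hv₁, hu₃ b hvb fun i _ => hb i, hle.trans ?_⟩
    rw [hsum, hfin I.X u hu₂, hfin I.Xᶜ v hv₂]
    · have hX : ((I.X ∩ Y).card : ℝ) = I.p - I.k := by
        rw [← hk', Nat.cast_sub I.k_le_p]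
      have hO : ((I.Xᶜ ∩ Y).card : ℝ) = I.k := by linarith
      rw [hX, hO]
      unfold dual dualIn dualOut bend
      exact le_rfl
    · intro j hj hjY
      refine hv₃ _ (ha j) fun i hi => ?_
      simp only [Finset.mem_inter, Finset.mem_compl] at hi
      exact hexch i j hi.2 hjY (hk.trans (hsub' i j hi.1))
    · intro j hj hjY
      refine hu₃ _ (hv₃ _ (ha j) fun i hi => ?_) fun i hi => ?_ <;>
      · simp only [Finset.mem_inter, Finset.mem_compl] at hi
        exact hexch i j hi.2 hjY (hk.trans (hsub'' i j hi.2 hjY hj))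
  · obtain ⟨w, hw₁, hw₂, hw₃⟩ := exists_level Y c a
    have hw (j : Fin n) (hj : j ∉ Y) : w ≤ c j := by
      refine hw₃ _ (ha j) fun i hi => hexch i j hi hj ?_
      have := hsub i j
      omega
    refine ⟨w, w, le_rfl, hw₁, hw₃ b hab fun i _ => hb i, hle.trans ?_⟩
    rw [hsum, hfin I.X w (fun i hi => hw₂ i (Finset.mem_inter.1 hi).2) fun i _ => hw i,
      hfin I.Xᶜ w (fun i hi => hw₂ i (Finset.mem_inter.1 hi).2) fun i _ => hw i]
    unfold dual dualIn dualOut bend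
    rw [← hcard']
    linarith

/-- An upper bound of the dual objective over all scenarios, by the budget constraint alone on one hand
and by the cost intervals alone on the other hand. -/
noncomputable def bound (u v : ℝ) : ℝ := min (I.Γ + I.dual I.lo u v) (I.dual I.hi u v)

theorem dual_le_bound {c : Fin n → ℝ} (hc : c ∈ I.scenarios) (u v : ℝ) :
    I.dual c u v ≤ I.bound u v := by
  obtain ⟨δ, hδ, hΓ, hc⟩ := hc
  refine le_min ?_ ?_
  · have hpart (S : Finset (Fin n)) (κ w : ℝ) : bend S κ c w ≤ bend S κ I.lo w + ∑ i ∈ S, δ i := by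
      have : ∑ i ∈ S, max 0 (w - I.lo i) ≤ ∑ i ∈ S, max 0 (w - c i) + ∑ i ∈ S, δ i := by
        rw [← Finset.sum_add_distrib]
        refine Finset.sum_le_sum fun i _ => max_le ?_ ?_
        · exact add_nonneg (le_max_left _ _) (hδ i).1
        · have := le_max_right 0 (w - c i)
          have := hc i
          linarith
      unfold bend
      linarith
    have h₁ := hpart I.X (I.p - I.k) u
    have h₂ := hpart I.Xᶜ I.k v
    have h₃ := Finset.sum_add_sum_compl I.X δ
    unfold dual dualIn dualOut
    linarith
  · have (i : Fin n) : c i ≤ I.hi i := by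
      have := (hδ i).2
      rw [hc i, hi]
      linarith
    exact add_le_add (bend_mono_right (fun i _ => this i) _) (bend_mono_right (fun i _ => this i) _)

/-- The part of the budget that raises the items of `X` to the level `L`. -/
noncomputable def spendIn (L : ℝ) : ℝ :=
  I.dualIn I.hi L - I.dualIn I.lo L

/-- The part of the budget that raises the items outside `X` to the level `M`. -/
noncomputable def spendOut (M : ℝ) : ℝ := I.dualOut I.hi M - I.dualOut I.lo M

theorem spendIn_mono : Monotone I.spendIn := fun _ _ h => bend_sub_mono (fun i _ => I.lo_le_hi i) h

theorem spendOut_mono : Monotone I.spendOut :=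
  fun _ _ h => bend_sub_mono (fun i _ => I.lo_le_hi i) h

theorem spend_mono : Monotone fun u => (I.dualIn I.hi u + I.dualOut I.hi u) -
    (I.dualIn I.lo u + I.dualOut I.lo u) := by
  intro u v huv
  have h₁ := I.spendIn_mono huv
  have h₂ := I.spendOut_mono huv
  unfold spendIn at h₁
  unfold spendOut at h₂
  simp only
  linarith

/-- A scenario given by levels below optimal multipliers that use up as much of the budget as the
multipliers would is a worst one. -/
theorem isWorstScenario_of_levels {a b u v L M : ℝ} {c : Fin n → ℝ} (hab : a ≤ b)
    (ha : ∀ i, a ≤ I.lo i) (hb : ∀ i, I.hi i ≤ b) (huv : v ≤ u) (hLu : L ≤ u) (hMv : M ≤ v)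
    (hspend : I.spendIn L + I.spendOut M = min I.Γ (I.spendIn u + I.spendOut v))
    (hopt : ∀ u' v', v' ≤ u' → a ≤ v' → u' ≤ b → I.bound u' v' ≤ I.bound u v)
    (hc : I.IsCompatible L M c) :
    I.IsWorstScenario c ∧ I.bound u v = I.recoveryCost c := by
  have hpart (S : Finset (Fin n)) (κ l w : ℝ) (hlw : l ≤ w)
      (h : ∀ i ∈ S, c i = max (I.lo i) (min (I.hi i) l)) :
      bend S κ c w = bend S κ I.lo w + ∑ i ∈ S, (c i - I.lo i) ∧
        ∑ i ∈ S, (c i - I.lo i) = bend S κ I.hi l - bend S κ I.lo l := by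
    unfold bend
    constructor
    · rw [sub_add, ← Finset.sum_sub_distrib]
      congr 1
      refine Finset.sum_congr rfl fun i hi => ?_
      have := I.lo_le_hi i
      rw [h i hi]
      rcases le_total (I.lo i) l with h₁ | h₁
      · have h₂ : I.lo i ≤ min (I.hi i) l := le_min this h₁
        have h₃ := min_le_right (I.hi i) l
        rw [max_eq_right h₂, max_eq_right (a := 0) (by linarith),
          max_eq_right (a := 0) (by linarith)]
        ring
      · rw [max_eq_left (a := I.lo i) ((min_le_right _ _).trans h₁)]
        ring
    · rw [sub_sub_sub_cancel_left, ← Finset.sum_sub_distrib]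
      refine Finset.sum_congr rfl fun i hi => ?_
      have := I.lo_le_hi i
      rw [h i hi]
      rcases le_total (I.hi i) l with h₁ | h₁
      · rw [min_eq_left h₁, max_eq_right this, max_eq_right (by linarith),
          max_eq_right (by linarith)]
        ring
      · rw [min_eq_right h₁, max_eq_left (a := 0) (b := l - I.hi i) (by linarith), sub_zero]
        rcases le_total (I.lo i) l with h₂ | h₂
        · rw [max_eq_right h₂, max_eq_right (by linarith)]
        · rw [max_eq_left h₂, max_eq_left (by linarith), sub_self]
  obtain ⟨hX₁, hX₂⟩ := hpart I.X (I.p - I.k) L u hLu hc.1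
  obtain ⟨hO₁, hO₂⟩ := hpart I.Xᶜ I.k M v hMv fun i hi => hc.2 i (by simpa using hi)
  have hcI (i : Fin n) : I.lo i ≤ c i ∧ c i ≤ I.hi i := by
    have : ∃ l, c i = max (I.lo i) (min (I.hi i) l) := by
      by_cases hi : i ∈ I.X
      · exact ⟨_, hc.1 i hi⟩
      · exact ⟨_, hc.2 i hi⟩
    obtain ⟨l, hl⟩ := this
    rw [hl]
    exact ⟨le_max_left _ _, max_le (I.lo_le_hi i) (min_le_left _ _)⟩
  have hscen : c ∈ I.scenarios := by
    refine ⟨fun i => c i - I.lo i, fun i => ⟨by linarith [hcI i], ?_⟩, ?_, fun i => by ring⟩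
    · have := (hcI i).2
      unfold hi at this
      linarith
    · rw [← Finset.sum_add_sum_compl I.X, hX₂, hO₂]
      exact hspend.le.trans (min_le_left _ _)
  have hdual : I.dual c u v = I.bound u v := by
    have h₁ : I.dual c u v = I.dual I.lo u v + (I.spendIn L + I.spendOut M) := by
      unfold dual spendIn spendOut dualIn dualOut
      rw [hX₁, hO₁, hX₂, hO₂]
      ring
    rw [h₁, hspend, ← min_add_add_left, bound, add_comm]
    congr 1
    unfold dual spendIn spendOut dualIn dualOut
    ring
  have hle (c' : Fin n → ℝ) (hc' : c' ∈ I.scenarios) : I.recoveryCost c' ≤ I.bound u v := by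
    have hcc := hc'
    obtain ⟨δ, hδ, -, hc''⟩ := hcc
    obtain ⟨u', v', h₁, h₂, h₃, h₄⟩ := I.exists_recoveryCost_le_dual c' hab
      (fun i => by linarith [ha i, (hδ i).1, hc'' i]) fun i => by
        have := hb i
        unfold hi at this
        linarith [(hδ i).2, hc'' i]
    exact h₄.trans ((I.dual_le_bound hc' _ _).trans (hopt _ _ h₁ h₂ h₃))
  have hge : I.bound u v ≤ I.recoveryCost c := hdual ▸ I.dual_le_recoveryCost c huv
  exact ⟨⟨hscen, fun c' hc' => (hle c' hc').trans hge⟩, le_antisymm hge (hle c hscen)⟩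

end ARECInstance

/-! ### Concave functions that are affine between consecutive grid points -/

/-- `f` is concave, and affine on each of the intervals between two consecutive points of the grid
`z 0, …, z (N - 1)`. -/
structure GridConcave (z : ℕ → ℝ) (N : ℕ) (f : ℝ → ℝ) : Prop where
  concave : ConcaveOn ℝ Set.univ f
  affine : ∀ t, t + 1 < N → ∃ m, ∀ u, z t ≤ u → u ≤ z (t + 1) → f u = f (z t) + m * (u - z t)

theorem min_le_of_concave {f : ℝ → ℝ} (hf : ConcaveOn ℝ Set.univ f) {a b c : ℝ} (hab : a ≤ b)
    (hbc : b ≤ c) : min (f a) (f c) ≤ f b := by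
  refine hf.ge_on_segment (Set.mem_univ a) (Set.mem_univ c) ?_
  rw [segment_eq_Icc (hab.trans hbc)]
  exact ⟨hab, hbc⟩

/-- `w` is where the function `s` crosses the value `R` between `a` and `b`, or the end of the interval
nearest to the crossing. -/
def Crossing (s : ℝ → ℝ) (a b R w : ℝ) : Prop :=
  (R ≤ s w ∧ w = a) ∨ (s w ≤ R ∧ w = b) ∨ (s w = R ∧ a ≤ w ∧ w ≤ b)

theorem Crossing.mem {s : ℝ → ℝ} {a b R w : ℝ} (h : Crossing s a b R w) (hab : a ≤ b) :
    a ≤ w ∧ w ≤ b := by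
  rcases h with ⟨-, rfl⟩ | ⟨-, rfl⟩ | ⟨-, h⟩
  · exact ⟨le_rfl, hab⟩
  · exact ⟨hab, le_rfl⟩
  · exact h

/-- The minimum of two concave functions is largest at their crossing between the two maximizers. -/
theorem Crossing.min_le {f₁ f₂ : ℝ → ℝ} (h₁ : ConcaveOn ℝ Set.univ f₁)
    (h₂ : ConcaveOn ℝ Set.univ f₂) {a b m₁ m₂ C₁ C₂ w : ℝ} (hm₁ : a ≤ m₁ ∧ m₁ ≤ b)
    (hm₂ : a ≤ m₂ ∧ m₂ ≤ b) (hf₁ : ∀ v, a ≤ v → v ≤ b → f₁ v ≤ f₁ m₁)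
    (hf₂ : ∀ v, a ≤ v → v ≤ b → f₂ v ≤ f₂ m₂)
    (hw : Crossing (fun u => f₂ u - f₁ u) m₁ m₂ (C₁ - C₂) w) {v : ℝ} (hav : a ≤ v) (hvb : v ≤ b) :
    min (C₁ + f₁ v) (C₂ + f₂ v) ≤ min (C₁ + f₁ w) (C₂ + f₂ w) := by
  rcases hw with ⟨hR, rfl⟩ | ⟨hR, rfl⟩ | ⟨hR, hl, hr⟩
  · have := hf₁ v hav hvb
    exact (min_le_left _ _).trans (le_min (by linarith) (by linarith))
  · have := hf₂ v hav hvb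
    exact (min_le_right _ _).trans (le_min (by linarith) (by linarith))
  · rcases le_total v w with h | h
    · have h₃ := min_le_of_concave h₂ h hr
      rw [min_eq_left (hf₂ v hav hvb)] at h₃
      exact (min_le_right _ _).trans (le_min (by linarith) (by linarith))
    · have h₃ := min_le_of_concave h₁ hl h
      rw [min_eq_right (hf₁ v hav hvb)] at h₃
      exact (min_le_left _ _).trans (le_min (by linarith) (by linarith))

/-- The first points of a grid are increasing. -/
def GridMono (z : ℕ → ℝ) (N : ℕ) : Prop := ∀ s t, s ≤ t → t < N → z s ≤ z t

theorem GridMono.exists_cell {z : ℕ → ℝ} {N : ℕ} (hN : 2 ≤ N) {u : ℝ}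
    (h0 : z 0 ≤ u) (hu : u ≤ z (N - 1)) : ∃ t, t + 1 < N ∧ z t ≤ u ∧ u ≤ z (t + 1) := by
  by_contra! H
  have (t : ℕ) : t < N → z t ≤ u := by
    induction t with
    | zero => exact fun _ => h0
    | succ t ih => exact fun ht => (H t ht (ih (by omega))).le
  have h₁ := H (N - 2) (by omega) (this _ (by omega))
  rw [show N - 2 + 1 = N - 1 by omega] at h₁
  linarith

namespace GridConcave

variable {z : ℕ → ℝ} {N : ℕ} {f g : ℝ → ℝ}

theorem add (hf : GridConcave z N f) (hg : GridConcave z N g) :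
    GridConcave z N fun u => f u + g u := by
  refine ⟨hf.concave.add hg.concave, fun t ht => ?_⟩
  obtain ⟨m, hm⟩ := hf.affine t ht
  obtain ⟨m', hm'⟩ := hg.affine t ht
  refine ⟨m + m', fun u h₁ h₂ => ?_⟩
  rw [hm u h₁ h₂, hm' u h₁ h₂]
  ring

/-- Linear interpolation is exact. -/
theorem interpolate (hf : GridConcave z N f) (hz : GridMono z N) {t : ℕ} {θ : ℝ}
    (ht' : θ = 0 ∨ t + 1 < N) (h0 : 0 ≤ θ) (h1 : θ ≤ 1) :
    f (z t + θ * (z (t + 1) - z t)) = f (z t) + θ * (f (z (t + 1)) - f (z t)) := by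
  rcases ht' with rfl | ht'
  · simp
  obtain ⟨m, hm⟩ := hf.affine t ht'
  have hle : z t ≤ z (t + 1) := hz t (t + 1) (by omega) ht'
  rw [hm _ _ _, hm (z (t + 1)) hle le_rfl]
  · ring
  · nlinarith
  · nlinarith

/-- A maximizer on the grid is a maximizer between the ends of the grid. -/
theorem le_of_grid (hf : GridConcave z N f) (hN : 2 ≤ N) {x : ℝ} (hm : ∀ t < N, f (z t) ≤ x)
    {u : ℝ} (h0 : z 0 ≤ u) (hu : u ≤ z (N - 1)) : f u ≤ x := by
  obtain ⟨t, ht, h₁, h₂⟩ := GridMono.exists_cell hN h0 hu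
  obtain ⟨m, hm'⟩ := hf.affine t ht
  have h₃ := hm t (by omega)
  have h₄ := hm (t + 1) ht
  have h₅ := hm' u h₁ h₂
  have h₆ := hm' _ (h₁.trans h₂) le_rfl
  rcases le_total 0 m with h | h <;> nlinarith

theorem le_min_index (hf : GridConcave z N f) (hz : GridMono z N) (hN : 2 ≤ N) {i t : ℕ}
    (ht : t < N) (hi : i < N) (hm : ∀ t < N, f (z t) ≤ f (z i)) {v : ℝ} (h0 : z 0 ≤ v)
    (hv : v ≤ z t) : f v ≤ f (z (min i t)) := by
  have hb (v : ℝ) (h : z 0 ≤ v) (h' : v ≤ z t) : f v ≤ f (z i) :=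
    hf.le_of_grid hN hm h (h'.trans (hz _ _ (by omega) (by omega)))
  rcases le_total i t with h | h
  · rw [min_eq_left h]
    exact hb v h0 hv
  · rw [min_eq_right h]
    have := min_le_of_concave hf.concave hv (hz _ _ h hi)
    rwa [min_eq_left (hb v h0 hv)] at this

theorem le_max_index (hf : GridConcave z N f) (hz : GridMono z N) (hN : 2 ≤ N) {i t : ℕ}
    (ht : t < N) (hm : ∀ t < N, f (z t) ≤ f (z i)) {v : ℝ} (hv : z t ≤ v)
    (h1 : v ≤ z (N - 1)) : f v ≤ f (z (max i t)) := by
  have hb : f v ≤ f (z i) :=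
    hf.le_of_grid hN hm ((hz _ _ (Nat.zero_le _) ht).trans hv) h1
  rcases le_total i t with h | h
  · rw [max_eq_right h]
    have := min_le_of_concave hf.concave (hz _ _ h ht) hv
    rwa [min_eq_right hb] at this
  · rw [max_eq_left h]
    exact hb

end GridConcave

/-- Moving along a direction that decreases one of finitely many nonnegative affine functions until the
first of them vanishes. -/
theorem exists_step {ι : Type*} [Fintype ι] (g d : ι → ℝ) (hg : ∀ i, 0 ≤ g i) (hd : ∃ i, d i < 0) :
    ∃ r, 0 ≤ r ∧ (∀ i, 0 ≤ g i + r * d i) ∧ ∃ i, g i + r * d i = 0 := by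
  classical
  obtain ⟨i, hi, hmin⟩ := (Finset.univ.filter fun i => d i < 0).exists_min_image
    (fun i => g i / (-d i)) (by obtain ⟨i, hi⟩ := hd; exact ⟨i, by simpa using hi⟩)
  have hi : d i < 0 := by simpa using hi
  have hr : 0 ≤ g i / (-d i) := div_nonneg (hg i) (by linarith)
  refine ⟨g i / (-d i), hr, fun j => ?_, i, by have := hi.ne; field_simp; ring⟩
  rcases le_or_gt 0 (d j) with h | h
  · have := mul_nonneg hr h
    linarith [hg j]
  · have h₁ := hmin j (by simpa using h)
    rw [le_div_iff₀ (by linarith)] at h₁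
    linarith

/-- Two linear functionals on the plane are nonnegative in a common direction. -/
theorem exists_direction (a b c d : ℝ) :
    ∃ x y : ℝ, (x ≠ 0 ∨ y ≠ 0) ∧ 0 ≤ a * x + b * y ∧ 0 ≤ c * x + d * y := by
  by_cases h : a = 0 ∧ b = 0
  · obtain ⟨rfl, rfl⟩ := h
    by_cases h' : c = 0 ∧ d = 0
    · obtain ⟨rfl, rfl⟩ := h'
      exact ⟨1, 0, by simp⟩
    · exact ⟨c, d, by tauto, by simp, by nlinarith [sq_nonneg c, sq_nonneg d]⟩
  · rcases le_total 0 (c * b - d * a) with h' | h'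
    · exact ⟨b, -a, by rw [neg_ne_zero]; tauto, by linarith, by linarith⟩
    · exact ⟨-b, a, by rw [neg_ne_zero]; tauto, by linarith, by linarith⟩

/-- Inside a cell of the grid the two functions are affine, so that both of them can be increased, or
kept, by moving to the boundary of the cell or to the diagonal. -/
theorem exists_le_of_grid {z : ℕ → ℝ} {N : ℕ} {f₁ f₂ g₁ g₂ : ℝ → ℝ} (hN : 2 ≤ N)
    (hz : GridMono z N)
    (hf₁ : GridConcave z N f₁) (hf₂ : GridConcave z N f₂) (hg₁ : GridConcave z N g₁)
    (hg₂ : GridConcave z N g₂) {u v : ℝ} (hvu : v ≤ u) (hv : z 0 ≤ v) (hu : u ≤ z (N - 1)) :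
    ∃ u' v', v' ≤ u' ∧ z 0 ≤ v' ∧ u' ≤ z (N - 1) ∧ f₁ u + g₁ v ≤ f₁ u' + g₁ v' ∧
      f₂ u + g₂ v ≤ f₂ u' + g₂ v' ∧ ((∃ t < N, u' = z t) ∨ (∃ t < N, v' = z t) ∨ u' = v') := by
  obtain ⟨s, hs, hs₁, hs₂⟩ := GridMono.exists_cell hN (hv.trans hvu) hu
  obtain ⟨t, ht, ht₁, ht₂⟩ := GridMono.exists_cell hN hv (hvu.trans hu)
  obtain ⟨a, ha⟩ := hf₁.affine s hs
  obtain ⟨b, hb⟩ := hg₁.affine t ht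
  obtain ⟨c, hc⟩ := hf₂.affine s hs
  obtain ⟨d, hd⟩ := hg₂.affine t ht
  obtain ⟨x, y, hxy, h₁, h₂⟩ := exists_direction a b c d
  obtain ⟨r, hr, hr₁, i, hi⟩ := exists_step ![u - z s, z (s + 1) - u, v - z t, z (t + 1) - v, u - v]
    ![x, -x, y, -y, x - y] (by
      intro i
      fin_cases i <;> simp <;> assumption) (by
      rcases hxy with h | h <;> rcases lt_or_gt_of_ne h with h | h
      · exact ⟨0, by simpa using h⟩
      · exact ⟨1, by simpa using h⟩
      · exact ⟨2, by simpa using h⟩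
      · exact ⟨3, by simpa using h⟩)
  have e₀ := hr₁ 0
  have e₁ := hr₁ 1
  have e₂ := hr₁ 2
  have e₃ := hr₁ 3
  have e₄ := hr₁ 4
  simp at e₀ e₁ e₂ e₃ e₄
  refine ⟨u + r * x, v + r * y, by linarith, ?_, ?_, ?_, ?_, ?_⟩
  · exact (hz 0 t (Nat.zero_le _) (by omega)).trans (by linarith)
  · refine le_trans ?_ (hz (s + 1) (N - 1) (by omega) (by omega))
    linarith
  · rw [ha u hs₁ hs₂, hb v ht₁ ht₂, ha (u + r * x) (by linarith) (by linarith),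
      hb (v + r * y) (by linarith) (by linarith)]
    nlinarith [mul_nonneg hr h₁]
  · rw [hc u hs₁ hs₂, hd v ht₁ ht₂, hc (u + r * x) (by linarith) (by linarith),
      hd (v + r * y) (by linarith) (by linarith)]
    nlinarith [mul_nonneg hr h₂]
  · fin_cases i <;> simp at hi
    · exact Or.inl ⟨s, by omega, by linarith⟩
    · exact Or.inl ⟨s + 1, hs, by linarith⟩
    · exact Or.inr (Or.inl ⟨t, by omega, by linarith⟩)
    · exact Or.inr (Or.inl ⟨t + 1, ht, by linarith⟩)
    · exact Or.inr (Or.inr (by linarith))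

/-! ### Sorting -/

namespace RealRAM

/-- Moves the smaller head of the two runs of the current block to the output. -/
def mergeStep : Program :=
  .cond (.both (.natLt (.var 6) (.var 8)) (.neg (.both (.natLt (.var 7) (.var 9))
      (.realLt (.read 3 (.var 7)) (.read 3 (.var 6))))))
    (.seq (.writeReal 4 (.var 5) (.read 3 (.var 6))) <|
      .seq (.writeNat 2 (.var 5) (.read 1 (.var 6))) <|
      .setNat 6 (.plus (.var 6) (.lit 1)))
    (.seq (.writeReal 4 (.var 5) (.read 3 (.var 7))) <|
      .seq (.writeNat 2 (.var 5) (.read 1 (.var 7))) <|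
      .setNat 7 (.plus (.var 7) (.lit 1)))

/-- One pass of bottom-up merge sort: merges the runs of length `w` (variable `4`) of the keys in the
real array `3`, with their tags in the natural array `1`, into runs of length `2 w` in the real
array `4` and the natural array `2`. The variables `5`, …, `9` hold the output position, the positions
in the two runs of the current block, and the ends of the two runs. -/
def mergePass : Program :=
  .seq (.setNat 9 (.lit 0)) <|
  .forLoop 5 3 <|
    .seq
      (.cond (.natLt (.var 5) (.var 9)) .skip <|
        .seq (.setNat 6 (.var 5)) <|
        -- the minimum of `a` and `b` is `a - (a - b)`
        .seq (.setNat 8 (.minus (.plus (.var 5) (.var 4))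
          (.minus (.plus (.var 5) (.var 4)) (.var 3)))) <|
        .seq (.setNat 7 (.var 8)) <|
        .setNat 9 (.minus (.plus (.plus (.var 5) (.var 4)) (.var 4))
          (.minus (.plus (.plus (.var 5) (.var 4)) (.var 4)) (.var 3))))
      mergeStep

/-- The runs of length `w` among the first `q` values of `f` are sorted. -/
def RunsSorted (w q : ℕ) (f : ℕ → ℝ) : Prop := ∀ x y, x ≤ y → y < q → x / w = y / w → f x ≤ f y

/-- The sum of `g` over the pairs of a key and a tag with index less than `q`. Two sequences of pairs
with equal sums for all `g` are rearrangements of each other. -/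
def pairSum (f : ℕ → ℝ) (T : ℕ → ℕ) (g : ℝ → ℕ → ℝ) (q : ℕ) : ℝ :=
  ∑ x ∈ Finset.range q, g (f x) (T x)

theorem pairSum_succ (f : ℕ → ℝ) (T : ℕ → ℕ) (g : ℝ → ℕ → ℝ) (q : ℕ) :
    pairSum f T g (q + 1) = pairSum f T g q + g (f q) (T q) := Finset.sum_range_succ _ _

/-- The state of a merging pass with output position `q`: the block that starts at `b` and ends at `e`
is being filled from the rests `i, …, m - 1` and `j, …, e - 1` of its two runs. -/
structure Merging (K : ℕ → ℝ) (T : ℕ → ℕ) (N w q : ℕ) (K' : ℕ → ℝ) (T' : ℕ → ℕ)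
    (b i j m e : ℕ) : Prop where
  dvd : 2 * w ∣ b
  hm : m = min (b + w) N
  he : e = min (b + 2 * w) N
  hbi : b ≤ i
  him : i ≤ m
  hmj : m ≤ j
  hje : j ≤ e
  hq : q + m = i + j
  sorted : RunsSorted (2 * w) q K'
  bound : ∀ x, b ≤ x → x < q →
    (∀ y, i ≤ y → y < m → K' x ≤ K y) ∧ ∀ y, j ≤ y → y < e → K' x ≤ K y
  sums : ∀ g, pairSum K' T' g q + pairSum K T g m = pairSum K T g i + pairSum K T g j

/-- At the end of a block, the next block starts. -/
theorem Merging.next {K : ℕ → ℝ} {T : ℕ → ℕ} {N w q : ℕ} {K' : ℕ → ℝ} {T' : ℕ → ℕ}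
    {b i j m e : ℕ} (h : Merging K T N w q K' T' b i j m e) (hqe : e ≤ q) (hqN : q < N) :
    Merging K T N w q K' T' q q (min (q + w) N) (min (q + w) N) (min (q + 2 * w) N) := by
  obtain ⟨dvd, hm, he, hbi, him, hmj, hje, hq, sorted, bound, sums⟩ := h
  have hi : i = m := by omega
  have hj : j = q := by omega
  subst hj
  have he' : j = b + 2 * w := by omega
  refine ⟨?_, rfl, rfl, le_rfl, by omega, le_rfl, by omega, by omega, sorted,
    fun x h₁ h₂ => by omega, fun g => ?_⟩
  · rw [he']
    exact dvd.add (dvd_refl _)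
  · have := sums g
    rw [hi] at this
    linarith

theorem div_eq_of_mem_block {w b x : ℕ} (h : w ∣ b) (h₁ : b ≤ x) (h₂ : x < b + w) :
    x / w = b / w := by
  obtain ⟨c, rfl⟩ := h
  have hw : 0 < w := by
    rcases Nat.eq_zero_or_pos w with rfl | h
    · omega
    · exact h
  rw [Nat.mul_div_cancel_left _ hw]
  exact Nat.div_eq_of_lt_le (by linarith [mul_comm c w]) (by nlinarith)

theorem le_of_div_eq {w b x y : ℕ} (h : w ∣ b) (hy : b ≤ y) (hxy : x / w = y / w) : b ≤ x := by
  obtain ⟨c, rfl⟩ := h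
  rcases Nat.eq_zero_or_pos w with rfl | hw
  · omega
  have h₁ : c ≤ y / w := (Nat.le_div_iff_mul_le hw).2 (by linarith [mul_comm c w])
  rw [← hxy, Nat.le_div_iff_mul_le hw] at h₁
  linarith [mul_comm c w]

section
variable {K : ℕ → ℝ} {T : ℕ → ℕ} {N w q : ℕ} {K' : ℕ → ℝ} {T' : ℕ → ℕ} {b i j m e : ℕ}

theorem RunsSorted.snoc {x₀ : ℝ} (hs : RunsSorted w q K') (hdvd : w ∣ b) (hbq : b ≤ q)
    (hb : ∀ x, b ≤ x → x < q → K' x ≤ x₀) :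
    RunsSorted w (q + 1) (Function.update K' q x₀) := by
  intro x y hxy hy hd
  rcases Nat.lt_succ_iff_lt_or_eq.1 hy with hy | rfl
  · rw [Function.update_of_ne (by omega), Function.update_of_ne (by omega)]
    exact hs x y hxy hy hd
  · rw [Function.update_self]
    rcases eq_or_lt_of_le hxy with rfl | hxy
    · rw [Function.update_self]
    · rw [Function.update_of_ne hxy.ne]
      exact hb x (le_of_div_eq hdvd hbq hd) hxy

theorem pairSum_update (g : ℝ → ℕ → ℝ) (x : ℝ) (y : ℕ) :
    pairSum (Function.update K' q x) (Function.update T' q y) g (q + 1) =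
      pairSum K' T' g q + g x y := by
  rw [pairSum_succ, Function.update_self, Function.update_self]
  congr 1
  refine Finset.sum_congr rfl fun z hz => ?_
  have : z ≠ q := (Finset.mem_range.1 hz).ne
  rw [Function.update_of_ne this, Function.update_of_ne this]

theorem Merging.left (h : Merging K T N w q K' T' b i j m e) (hK : RunsSorted w N K)
    (him : i < m) (hij : j < e → K i ≤ K j) :
    Merging K T N w (q + 1) (Function.update K' q (K i)) (Function.update T' q (T i))
      b (i + 1) j m e := by
  obtain ⟨dvd, hm, he, hbi, -, hmj, hje, hq, sorted, bound, sums⟩ := h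
  have hwb : w ∣ b := (Dvd.intro_left 2 rfl).trans dvd
  have hwm : j < e → w ∣ m := fun h => by
    rw [show m = b + w by omega]; exact hwb.add (dvd_refl _)
  refine ⟨dvd, hm, he, by omega, by omega, hmj, hje, by omega,
    sorted.snoc dvd (by omega) fun x h₁ h₂ => (bound x h₁ h₂).1 i le_rfl him, ?_, fun g => ?_⟩
  · have hl (y : ℕ) (h₁ : i ≤ y) (h₂ : y < m) : K i ≤ K y := by
      refine hK i y h₁ (by omega) ?_
      exact (div_eq_of_mem_block hwb hbi (by omega)).trans
        (div_eq_of_mem_block hwb (by omega) (by omega)).symm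
    have hr (y : ℕ) (h₁ : j ≤ y) (h₂ : y < e) : K i ≤ K y := by
      refine (hij (by omega)).trans (hK j y h₁ (by omega) ?_)
      exact (div_eq_of_mem_block (hwm (by omega)) hmj (by omega)).trans
        (div_eq_of_mem_block (hwm (by omega)) (by omega) (by omega)).symm
    intro x h₁ h₂
    rcases Nat.lt_succ_iff_lt_or_eq.1 h₂ with h₂ | rfl
    · rw [Function.update_of_ne h₂.ne]
      exact ⟨fun y h₃ => (bound x h₁ h₂).1 y (by omega), (bound x h₁ h₂).2⟩
    · rw [Function.update_self]
      exact ⟨fun y h₃ => hl y (by omega), hr⟩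
  · rw [pairSum_update, pairSum_succ]
    linarith [sums g]

theorem Merging.right (h : Merging K T N w q K' T' b i j m e) (hK : RunsSorted w N K)
    (hje : j < e) (hij : i < m → K j ≤ K i) :
    Merging K T N w (q + 1) (Function.update K' q (K j)) (Function.update T' q (T j))
      b i (j + 1) m e := by
  obtain ⟨dvd, hm, he, hbi, him, hmj, -, hq, sorted, bound, sums⟩ := h
  have hwb : w ∣ b := (Dvd.intro_left 2 rfl).trans dvd
  have hwm : w ∣ m := by
    rw [show m = b + w by omega]; exact hwb.add (dvd_refl _)
  refine ⟨dvd, hm, he, hbi, him, by omega, by omega, by omega,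
    sorted.snoc dvd (by omega) fun x h₁ h₂ => (bound x h₁ h₂).2 j le_rfl hje, ?_, fun g => ?_⟩
  · have hr (y : ℕ) (h₁ : j ≤ y) (h₂ : y < e) : K j ≤ K y := by
      refine hK j y h₁ (by omega) ?_
      exact (div_eq_of_mem_block hwm hmj (by omega)).trans
        (div_eq_of_mem_block hwm (by omega) (by omega)).symm
    have hl (y : ℕ) (h₁ : i ≤ y) (h₂ : y < m) : K j ≤ K y := by
      refine (hij (by omega)).trans (hK i y h₁ (by omega) ?_)
      exact (div_eq_of_mem_block hwb hbi (by omega)).trans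
        (div_eq_of_mem_block hwb (by omega) (by omega)).symm
    intro x h₁ h₂
    rcases Nat.lt_succ_iff_lt_or_eq.1 h₂ with h₂ | rfl
    · rw [Function.update_of_ne h₂.ne]
      exact ⟨(bound x h₁ h₂).1, fun y h₃ => (bound x h₁ h₂).2 y (by omega)⟩
    · rw [Function.update_self]
      exact ⟨hl, fun y h₃ => hr y (by omega)⟩
  · rw [pairSum_update, pairSum_succ]
    linarith [sums g]

end

theorem runs_mergeStep {K : ℕ → ℝ} {T : ℕ → ℕ} {N w q b : ℕ} {s : State} (h5 : s.natVar 5 = q)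
    (h9 : q < s.natVar 9) (hs : RunsSorted w N K) (hK : s.realArr 3 = K) (hT : s.natArr 1 = T)
    (hM : Merging K T N w q (s.realArr 4) (s.natArr 2) b (s.natVar 6) (s.natVar 7) (s.natVar 8)
      (s.natVar 9)) :
    Runs mergeStep s fun t s' => t ≤ 40 ∧ ∃ b, Merging K T N w (q + 1) (s'.realArr 4)
      (s'.natArr 2) b (s'.natVar 6) (s'.natVar 7) (s'.natVar 8) (s'.natVar 9) := by
  simp only [mergeStep, runs_cond, runs_seq, runs_writeReal, runs_writeNat, runs_setNat]
  constructor
  · intro h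
    simp [hK] at h
    simp [h5, hK, hT]
    exact ⟨b, hM.left hs h.1 h.2⟩
  · intro h
    simp [hK] at h
    simp [h5, hK, hT]
    have h1 := hM.hq
    have h2 := hM.him
    have h3 := hM.hmj
    have h4 := hM.hje
    exact ⟨b, hM.right hs (by omega) fun h' => (h h').2.le⟩

theorem runs_mergePass {s : State} (hw : 0 < s.natVar 4)
    (hs : RunsSorted (s.natVar 4) (s.natVar 3) (s.realArr 3)) :
    Runs mergePass s fun t s' => t ≤ s.natVar 3 * 88 + 10 ∧
      RunsSorted (2 * s.natVar 4) (s.natVar 3) (s'.realArr 4) ∧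
      (∀ g, pairSum (s'.realArr 4) (s'.natArr 2) g (s.natVar 3) =
        pairSum (s.realArr 3) (s.natArr 1) g (s.natVar 3)) := by
  obtain ⟨N, hN⟩ : ∃ N, s.natVar 3 = N := ⟨_, rfl⟩
  obtain ⟨w, hw'⟩ : ∃ w, s.natVar 4 = w := ⟨_, rfl⟩
  obtain ⟨K, hK⟩ : ∃ K, s.realArr 3 = K := ⟨_, rfl⟩
  obtain ⟨T, hT⟩ : ∃ T, s.natArr 1 = T := ⟨_, rfl⟩
  rw [hN, hw', hK] at hs
  rw [hw'] at hw
  rw [mergePass, runs_seq, runs_setNat]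
  refine (Runs.forLoop (fun q s' =>
    (s'.natVar 9 = 0 ∧ q = 0) ∨
    ∃ b, Merging K T N w q (s'.realArr 4) (s'.natArr 2) b (s'.natVar 6) (s'.natVar 7)
      (s'.natVar 8) (s'.natVar 9)) (B := 80) rfl rfl (by decide) (by simp) ?_).mono ?_
  · intro q s' hq hv hf hJ
    have e3 : s'.natVar 3 = N := by rw [hf.natVar 3 rfl]; simpa using hN
    have e4 : s'.natVar 4 = w := by rw [hf.natVar 4 rfl]; simpa using hw'
    have eK : s'.realArr 3 = K := by rw [hf.realArr 3 rfl]; simpa using hK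
    have eT : s'.natArr 1 = T := by rw [hf.natArr 1 rfl]; simpa using hT
    simp [hN] at hq
    simp only [runs_seq, runs_cond, runs_skip, runs_setNat]
    constructor
    · intro h
      simp [hv] at h
      rcases hJ with ⟨h9, hq0⟩ | ⟨b, hM⟩
      · omega
      refine (runs_mergeStep hv h hs eK eT hM).mono ?_
      rintro t s'' ⟨ht, b, hM⟩
      exact ⟨by simp; omega, Or.inr ⟨b, by simpa using hM⟩⟩
    · intro h
      simp [hv] at h
      have hM : Merging K T N w q (s'.realArr 4) (s'.natArr 2) q q (min (q + w) N) (min (q + w) N)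
          (min (q + 2 * w) N) := by
        rcases hJ with ⟨h9, rfl⟩ | ⟨b, hM⟩
        · refine ⟨dvd_zero _, rfl, rfl, le_rfl, by omega, le_rfl, by omega, by omega, ?_, ?_, ?_⟩
          · intro x y _ h; omega
          · intro x _ h; omega
          · intro g; simp [pairSum]
        · exact hM.next h hq
      refine (runs_mergeStep (q := q) (b := q) (T := T) ?_ ?_ hs ?_ ?_ ?_).mono ?_
      · simp [hv]
      · simp [hv, e3, e4]; omega
      · simp [eK]
      · simp [eT]
      · simp [hv, e3, e4]
        rw [show q + w - (q + w - N) = min (q + w) N by omega,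
          show q + w + w - (q + w + w - N) = min (q + 2 * w) N by omega]
        exact hM
      · rintro t s'' ⟨ht, b, hM⟩
        refine ⟨by simp; omega, Or.inr ⟨b, by simpa using hM⟩⟩
  · rintro t s' ⟨ht, hJ, hf⟩
    simp [hN] at ht hJ ⊢
    rw [hw', hK, hT]
    refine ⟨by omega, ?_⟩
    rcases hJ with ⟨-, h0⟩ | ⟨b, hM⟩
    · subst h0
      exact ⟨fun x y _ h => by omega, fun g => by simp [pairSum]⟩
    · obtain ⟨dvd, hm, he, hbi, him, hmj, hje, hq, sorted, bound, sums⟩ := hM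
      refine ⟨sorted, fun g => ?_⟩
      have := sums g
      rw [show s'.natVar 7 = N by omega, show s'.natVar 6 = s'.natVar 8 by omega] at this
      linarith

/-- Copies the output of a merging pass back. -/
def copyBack : Program :=
  .forLoop 5 3 <|
    .seq (.writeReal 3 (.var 5) (.read 4 (.var 5))) (.writeNat 1 (.var 5) (.read 2 (.var 5)))

theorem runs_copyBack (s : State) :
    Runs copyBack s fun t s' => t ≤ s.natVar 3 * 18 + 8 ∧
      (∀ x < s.natVar 3, s'.realArr 3 x = s.realArr 4 x) ∧
      ∀ x < s.natVar 3, s'.natArr 1 x = s.natArr 2 x := by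
  refine (Runs.forLoop (fun q s' => (∀ x < q, s'.realArr 3 x = s.realArr 4 x) ∧
    ∀ x < q, s'.natArr 1 x = s.natArr 2 x) (B := 10) rfl rfl (by decide) (by simp) ?_).mono ?_
  · intro q s' hq hv hf hJ
    have e4 := hf.realArr 4 rfl
    have e2 := hf.natArr 2 rfl
    simp [hv, e4, e2]
    constructor <;> intro x hx <;> rcases Nat.lt_or_eq_of_le hx with hx | rfl
    · rw [Function.update_of_ne hx.ne]
      exact hJ.1 x hx
    · simp
    · rw [Function.update_of_ne hx.ne]
      exact hJ.2 x hx
    · simp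
  · rintro t s' ⟨ht, hJ, -⟩
    exact ⟨by omega, hJ⟩

/-- Sorts the keys in the real array `3`, with their tags in the natural array `1`. -/
def mergeSort : Program :=
  .seq (.setNat 4 (.lit 1)) <|
  .loop (.natLt (.var 4) (.var 3)) <|
    .seq mergePass <| .seq copyBack <| .setNat 4 (.plus (.var 4) (.var 4))

theorem pairSum_congr {f f' : ℕ → ℝ} {T T' : ℕ → ℕ} {N : ℕ} (hf : ∀ x < N, f x = f' x)
    (hT : ∀ x < N, T x = T' x) (g : ℝ → ℕ → ℝ) : pairSum f T g N = pairSum f' T' g N :=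
  Finset.sum_congr rfl fun x hx => by
    rw [hf x (Finset.mem_range.1 hx), hT x (Finset.mem_range.1 hx)]

theorem runs_mergeSort (s : State) :
    Runs mergeSort s fun t s' =>
      t ≤ (Nat.log 2 (s.natVar 3) + 1) * (s.natVar 3 * 106 + 30) + 10 ∧
      GridMono (s'.realArr 3) (s.natVar 3) ∧
      (∀ g, pairSum (s'.realArr 3) (s'.natArr 1) g (s.natVar 3) =
        pairSum (s.realArr 3) (s.natArr 1) g (s.natVar 3)) := by
  obtain ⟨N, hN⟩ : ∃ N, s.natVar 3 = N := ⟨_, rfl⟩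
  rw [mergeSort, runs_seq, runs_setNat, hN]
  refine (Runs.loop (fun m s' => N ≤ s'.natVar 4 * 2 ^ m ∧ 0 < s'.natVar 4 ∧ s'.natVar 3 = N ∧
    RunsSorted (s'.natVar 4) N (s'.realArr 3) ∧
    ∀ g, pairSum (s'.realArr 3) (s'.natArr 1) g N = pairSum (s.realArr 3) (s.natArr 1) g N)
    (m := Nat.log 2 N + 1) (B := N * 106 + 26) ?_ ?_ ?_).mono ?_
  · simp
    refine ⟨(Nat.lt_pow_succ_log_self (by norm_num) N).le, hN, fun x y h₁ h₂ h₃ => ?_⟩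
    rw [Nat.div_one, Nat.div_one] at h₃
    rw [h₃]
  · rintro s' ⟨h₁, h₂, h₃, -⟩
    simp at h₁ ⊢
    omega
  · rintro m s₁ - ⟨h₁, h₂, h₃, h₄, h₅⟩ -
    rw [runs_seq]
    rw [← h₃] at h₄
    refine (runs_mergePass h₂ h₄).frame.mono ?_
    rintro t₁ s₂ ⟨⟨ht₁, hs₂, hp₂⟩, hf₂⟩
    rw [runs_seq]
    refine (runs_copyBack s₂).frame.mono ?_
    rintro t₂ s₃ ⟨⟨ht₂, hr₃, hn₃⟩, hf₃⟩
    have e₁ : s₂.natVar 3 = s₁.natVar 3 := hf₂.natVar 3 rfl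
    have e₂ : s₃.natVar 3 = s₂.natVar 3 := hf₃.natVar 3 rfl
    have e₃ : s₂.natVar 4 = s₁.natVar 4 := hf₂.natVar 4 rfl
    have e₄ : s₃.natVar 4 = s₂.natVar 4 := hf₃.natVar 4 rfl
    rw [e₁, h₃] at hr₃ hn₃ ht₂
    rw [h₃] at hs₂ hp₂ ht₁
    simp [e₁, e₂, e₃, e₄, h₃]
    refine ⟨by omega, ?_, h₂, ?_, fun g => ?_⟩
    · calc N ≤ _ := h₁
        _ = _ := by ring
    · intro x y h h' hd
      rw [hr₃ x (by omega), hr₃ y h']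
      exact hs₂ x y h h' (by rwa [two_mul])
    · rw [pairSum_congr hr₃ hn₃, hp₂, h₅]
  · rintro t s' ⟨ht, ⟨m, h₁, h₂, h₃, h₄, h₅⟩, hb⟩
    simp only [Test.cost, NatExpr.cost, add_assoc, Nat.reduceAdd] at ht
    simp [h₃] at hb ⊢
    refine ⟨by omega, fun x y h h' => h₄ x y h h' ?_, h₅⟩
    rw [Nat.div_eq_of_lt (by omega), Nat.div_eq_of_lt (by omega)]

end RealRAM

/-! ### Tabulating, maximizing and searching -/

/-- The function `u ↦ κ u - ∑ (u - z x)⁺`, the sum running over the indices `x < N` with the tag `τ`. -/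
def tagBend (z : ℕ → ℝ) (T : ℕ → ℕ) (N τ : ℕ) (κ : ℝ) : ℝ → ℝ :=
  bend ((Finset.range N).filter fun x => T x = τ) κ z

/-- The number of indices `x < t` with the tag `τ`. -/
def tagCount (T : ℕ → ℕ) (τ t : ℕ) : ℕ := ((Finset.range t).filter fun x => T x = τ).card

theorem tagCount_succ (T : ℕ → ℕ) (τ t : ℕ) :
    tagCount T τ (t + 1) = tagCount T τ t + if T t = τ then 1 else 0 := by
  unfold tagCount
  rw [Finset.range_add_one, Finset.filter_insert]
  split_ifs <;> simp

theorem tagBend_zero {z : ℕ → ℝ} {N : ℕ} (hz : GridMono z N) (T : ℕ → ℕ) (τ : ℕ) (κ : ℝ) :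
    tagBend z T N τ κ (z 0) = κ * z 0 := by
  unfold tagBend bend
  rw [Finset.sum_eq_zero, sub_zero]
  intro x hx
  have := hz 0 x (Nat.zero_le _) (Finset.mem_range.1 (Finset.mem_filter.1 hx).1)
  exact max_eq_left (by linarith)

theorem tagBend_succ {z : ℕ → ℝ} {N : ℕ} (hz : GridMono z N) (T : ℕ → ℕ) (τ : ℕ) (κ : ℝ) {t : ℕ}
    (ht : t + 1 < N) : tagBend z T N τ κ (z (t + 1)) =
      tagBend z T N τ κ (z t) + (κ - tagCount T τ (t + 1)) * (z (t + 1) - z t) := by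
  have h₁ : (tagCount T τ (t + 1) : ℝ) * (z (t + 1) - z t) =
      ∑ x ∈ (Finset.range N).filter fun x => T x = τ, if x < t + 1 then z (t + 1) - z t else 0 := by
    rw [← Finset.sum_filter, Finset.sum_const, nsmul_eq_mul, tagCount, Finset.filter_filter]
    congr 3
    ext x
    simp only [Finset.mem_filter, Finset.mem_range]
    exact ⟨fun h => ⟨by omega, h.2, h.1⟩, fun h => ⟨h.2.2, h.2.1⟩⟩
  have h₂ : ∑ x ∈ (Finset.range N).filter fun x => T x = τ, max 0 (z (t + 1) - z x) =
      ∑ x ∈ (Finset.range N).filter fun x => T x = τ, max 0 (z t - z x) +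
      (tagCount T τ (t + 1) : ℝ) * (z (t + 1) - z t) := by
    rw [h₁, ← Finset.sum_add_distrib]
    refine Finset.sum_congr rfl fun x hx => ?_
    have hx := Finset.mem_range.1 (Finset.mem_filter.1 hx).1
    have h₃ := hz t (t + 1) (by omega) ht
    split_ifs with h
    · have h₄ := hz x t (by omega) (by omega)
      rw [max_eq_right (by linarith), max_eq_right (by linarith)]
      ring
    · have h₄ := hz (t + 1) x (by omega) hx
      rw [max_eq_left (by linarith), max_eq_left (by linarith), add_zero]
  unfold tagBend bend
  rw [h₂]
  ring

theorem gridConcave_tagBend {z : ℕ → ℝ} {N : ℕ} (hz : GridMono z N) (T : ℕ → ℕ) (τ : ℕ) (κ : ℝ) :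
    GridConcave z N (tagBend z T N τ κ) := by
  refine ⟨concaveOn_bend, fun t ht => exists_bend_eq fun x hx => ?_⟩
  have hx := Finset.mem_range.1 (Finset.mem_filter.1 hx).1
  rcases Nat.lt_or_ge t x with h | h
  · exact Or.inr (hz _ _ h hx)
  · exact Or.inl (hz _ _ h (by omega))

namespace RealRAM

/-- Writes the values of `tagBend` at the points of the sorted grid in the real array `3` to the real
array `a`. The real variables `11` and `12` hold the slope and the value. -/
def tabulate (τ : ℕ) (κ : NatExpr) (a : ℕ) : Program :=
  .seq (.setReal 11 (.ofNat κ)) <|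
  .seq (.setReal 12 (.times (.var 11) (.read 3 (.lit 0)))) <|
  .forLoop 5 3 <|
    .seq (.writeReal a (.var 5) (.var 12)) <|
    .seq
      (.cond (.both (.neg (.natLt (.read 1 (.var 5)) (.lit τ)))
          (.neg (.natLt (.lit τ) (.read 1 (.var 5)))))
        (.setReal 11 (.minus (.var 11) (.ofNat (.lit 1)))) .skip) <|
    .setReal 12 (.plus (.var 12) (.times (.var 11)
      (.minus (.read 3 (.plus (.var 5) (.lit 1))) (.read 3 (.var 5)))))

theorem runs_tabulate {τ : ℕ} {κ : NatExpr} {a : ℕ} (ha : a ≠ 3) {s : State} {N : ℕ}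
    (hN : s.natVar 3 = N) (hN0 : 0 < N) (hz : GridMono (s.realArr 3) N) :
    Runs (tabulate τ κ a) s fun t s' => t ≤ N * 60 + κ.cost + 20 ∧ ∀ x < N, s'.realArr a x =
      tagBend (s.realArr 3) (s.natArr 1) N τ (κ.eval s) (s.realArr 3 x) := by
  obtain ⟨z, hz'⟩ : ∃ z, s.realArr 3 = z := ⟨_, rfl⟩
  obtain ⟨T, hT⟩ : ∃ T, s.natArr 1 = T := ⟨_, rfl⟩
  obtain ⟨k, hk⟩ : ∃ k : ℝ, κ.eval s = k := ⟨_, rfl⟩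
  rw [hz'] at hz
  rw [tabulate, runs_seq, runs_setReal, runs_seq, runs_setReal]
  refine (Runs.forLoop (fun t s' => (∀ x < t, s'.realArr a x = tagBend z T N τ k (z x)) ∧
    (t < N → s'.realVar 12 = tagBend z T N τ k (z t)) ∧ s'.realVar 11 = k - tagCount T τ t)
    (B := 50) rfl rfl (by decide) ?_ ?_).mono ?_
  · simp [hz', hk, tagCount, tagBend_zero hz]
  · intro t s₁ ht hv hf hJ
    have e3 : s₁.realArr 3 = z := by
      rw [hf.realArr 3 (by simp [Program.forLoop, Program.writesReal, ha])]
      simpa using hz'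
    have e1 : s₁.natArr 1 = T := by rw [hf.natArr 1 rfl]; simpa using hT
    simp [hN] at ht
    obtain ⟨h₁, h₂, h₃⟩ := hJ
    have hu (x : ℕ) (hx : x ≤ t) : Function.update (s₁.realArr a) t (s₁.realVar 12) x =
        tagBend z T N τ k (z x) := by
      rcases Nat.lt_or_eq_of_le hx with hx | rfl
      · rw [Function.update_of_ne hx.ne]
        exact h₁ x hx
      · rw [Function.update_self]
        exact h₂ ht
    simp [hv, e1, e3, Ne.symm ha]
    constructor
    · intro h₄ h₅
      have hcount : s₁.realVar 11 - 1 = k - tagCount T τ (t + 1) := by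
        rw [tagCount_succ, if_pos (by omega), h₃]
        push_cast
        ring
      refine ⟨hu, fun h => ?_, hcount⟩
      rw [tagBend_succ hz _ _ _ h, h₂ ht, hcount]
    · intro h₄
      have hcount : s₁.realVar 11 = k - tagCount T τ (t + 1) := by
        rw [tagCount_succ, if_neg (by omega), h₃]
        simp
      refine ⟨hu, fun h => ?_, hcount⟩
      rw [tagBend_succ hz _ _ _ h, h₂ ht, hcount]
  · rintro t s' ⟨ht, hJ, -⟩
    simp [hN] at ht hJ ⊢
    rw [hz', hT, hk]
    exact ⟨by omega, hJ.1⟩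

/-- Finds an index below the natural variable `3` with the largest entry of the real array `a`. -/
def argmax (a v : ℕ) : Program :=
  .seq (.setNat v (.lit 0)) <|
  .forLoop 5 3 <|
    .cond (.realLt (.read a (.var v)) (.read a (.var 5))) (.setNat v (.var 5)) .skip

theorem runs_argmax {a v : ℕ} (hv3 : v ≠ 3) (hv5 : v ≠ 5) {s : State} {N : ℕ}
    (hN : s.natVar 3 = N) (hN0 : 0 < N) :
    Runs (argmax a v) s fun t s' => t ≤ N * 20 + 20 ∧ s'.natVar v < N ∧
      (∀ x < N, s.realArr a x ≤ s.realArr a (s'.natVar v)) ∧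
      ∀ x < s'.natVar v, s.realArr a x < s.realArr a (s'.natVar v) := by
  obtain ⟨f, hf⟩ : ∃ f, s.realArr a = f := ⟨_, rfl⟩
  rw [argmax, runs_seq, runs_setNat]
  refine (Runs.forLoop (fun t s' => s'.natVar v < N ∧ s'.natVar v ≤ t ∧
    (∀ x < t, f x ≤ f (s'.natVar v)) ∧
    ∀ x < s'.natVar v, f x < f (s'.natVar v))
    (B := 12) (by simp [Program.setsNat, hv5]) (by simp [Program.setsNat, hv3])
    (by decide) ?_ ?_).mono ?_
  · simp [hv5, hN0]
  · intro t s₁ ht h5 hfr hJ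
    have ef : s₁.realArr a = f := by rw [hfr.realArr a rfl]; simpa using hf
    simp [Ne.symm hv3, hN] at ht
    obtain ⟨h₀, h₁, h₂, h₃⟩ := hJ
    simp [h5, ef, hv5]
    constructor
    · intro h
      refine ⟨ht, fun x hx => ?_, fun x hx => (h₂ x hx).trans_lt h⟩
      rcases Nat.lt_or_eq_of_le hx with hx | rfl
      · exact (h₂ x hx).trans h.le
      · exact le_rfl
    · intro h
      refine ⟨h₀, by omega, fun x hx => ?_, h₃⟩
      rcases Nat.lt_or_eq_of_le hx with hx | rfl
      · exact h₂ x hx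
      · exact h
  · rintro t s' ⟨ht, hJ, -⟩
    simp [hN, Ne.symm hv3] at ht hJ ⊢
    rw [hf]
    exact ⟨by omega, hJ.1, hJ.2.2⟩

/-- The difference of the entries of two real arrays. -/
def diffAt (a b : ℕ) (i : NatExpr) : RealExpr := .minus (.read b i) (.read a i)

/-- Bisection for the place between the indices in the natural variables `17` and `18` at which the
difference of the real arrays `b` and `a` reaches the value in the real variable `7`. The place is returned
as an index, in the variable `17`, and a fraction of the distance to the next index, in the real
variable `8`. -/
def locate (a b : ℕ) : Program :=
  .cond (.realLt (diffAt a b (.var 17)) (.var 7))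
    (.cond (.realLt (.var 7) (diffAt a b (.var 18)))
      (.seq
        (.loop (.natLt (.plus (.var 17) (.lit 1)) (.var 18)) <|
          .seq (.setNat 19 (.half (.plus (.var 17) (.var 18)))) <|
          .cond (.realLt (.var 7) (diffAt a b (.var 19)))
            (.setNat 18 (.var 19)) (.setNat 17 (.var 19))) <|
        .setReal 8 (.divide (.minus (.var 7) (diffAt a b (.var 17)))
          (.minus (diffAt a b (.plus (.var 17) (.lit 1))) (diffAt a b (.var 17)))))
      (.seq (.setNat 17 (.var 18)) (.setReal 8 (.ofNat (.lit 0)))))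
    (.setReal 8 (.ofNat (.lit 0)))

/-- The place `(j, θ)` is where the sequence `d`, interpolated linearly, takes the value `R` between the
indices `l` and `r`, or the end of this range nearest to it. -/
def Located (d : ℕ → ℝ) (l r : ℕ) (R : ℝ) (j : ℕ) (θ : ℝ) : Prop :=
  (R ≤ d j ∧ j = l ∧ θ = 0) ∨ (d j ≤ R ∧ j = r ∧ θ = 0) ∨
    (d j + θ * (d (j + 1) - d j) = R ∧ l ≤ j ∧ j + 1 ≤ r ∧ 0 ≤ θ ∧ θ ≤ 1)

theorem runs_locate {a b : ℕ} {s : State} {N l r : ℕ} {R : ℝ} (hl : s.natVar 17 = l)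
    (hr : s.natVar 18 = r) (hR : s.realVar 7 = R) (hlr : l ≤ r) (hrN : r ≤ N) :
    Runs (locate a b) s fun t s' => t ≤ (Nat.log 2 N + 1) * 40 + 60 ∧
      Located (fun x => s.realArr b x - s.realArr a x) l r R (s'.natVar 17) (s'.realVar 8) := by
  obtain ⟨d, hd⟩ : ∃ d, (fun x => s.realArr b x - s.realArr a x) = d := ⟨_, rfl⟩
  have hd' (x : ℕ) : s.realArr b x - s.realArr a x = d x := by rw [← hd]
  rw [hd, locate, runs_cond]
  constructor
  · intro h₁
    rw [runs_cond]
    simp [diffAt, hd', hl, hR] at h₁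
    constructor
    · intro h₂
      simp [diffAt, hd', hr, hR] at h₂
      have hlt : l < r := lt_of_le_of_ne hlr (by rintro rfl; linarith)
      rw [runs_seq]
      refine (Runs.frame (Runs.loop (fun m s' => s'.natVar 18 - s'.natVar 17 ≤ 2 ^ m ∧
        s'.natVar 17 < s'.natVar 18 ∧ l ≤ s'.natVar 17 ∧ s'.natVar 18 ≤ r ∧
        d (s'.natVar 17) ≤ R ∧ R < d (s'.natVar 18)) (B := 30)
        (m := Nat.log 2 N + 1) ⟨?_, ?_⟩ ?_ ?_)).mono ?_
      · rw [hl, hr]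
        have := Nat.lt_pow_succ_log_self (b := 2) (by norm_num) N
        omega
      · rw [hl, hr]
        exact ⟨hlt, le_rfl, le_rfl, h₁.le, h₂⟩
      · rintro s' ⟨h₃, -⟩
        simp at h₃ ⊢
        omega
      · rintro m s₁ hf ⟨h₃, h₄, h₅, h₆, h₇, h₈⟩ h₉
        have ea : s₁.realArr a = s.realArr a := hf.realArr a rfl
        have eb : s₁.realArr b = s.realArr b := hf.realArr b rfl
        have e7 : s₁.realVar 7 = R := (hf.realVar 7 rfl).trans hR
        rw [pow_succ] at h₃
        simp at h₉
        simp [diffAt, ea, eb, hd', e7]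
        constructor
        · intro h
          exact ⟨by omega, by omega, by omega, by omega, h₇, h⟩
        · intro h
          exact ⟨by omega, by omega, by omega, by omega,
            by linarith [hd' ((s₁.natVar 17 + s₁.natVar 18) / 2)], h₈⟩
      · rintro t s₁ ⟨⟨ht, ⟨m, -, h₄, h₅, h₆, h₇, h₈⟩, h₉⟩, hf⟩
        have ea : s₁.realArr a = s.realArr a := hf.realArr a rfl
        have eb : s₁.realArr b = s.realArr b := hf.realArr b rfl
        have e7 : s₁.realVar 7 = R := (hf.realVar 7 rfl).trans hR
        simp at h₉
        have e18 : s₁.natVar 18 = s₁.natVar 17 + 1 := by omega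
        rw [e18] at h₈ h₆
        simp [diffAt, ea, eb, hd', e7] at ht ⊢
        refine ⟨by omega, Or.inr (Or.inr ⟨?_, h₅, h₆, ?_, ?_⟩)⟩
        · have : d (s₁.natVar 17 + 1) - d (s₁.natVar 17) ≠ 0 := by linarith
          rw [div_mul_cancel₀ _ this]
          ring
        · exact div_nonneg (by linarith) (by linarith)
        · exact (div_le_one (by linarith)).2 (by linarith)
    · intro h₂
      simp [diffAt, hd', hr, hR] at h₂
      simp [diffAt, hr]
      exact Or.inr (Or.inl ⟨h₂, rfl, rfl⟩)
  · intro h₁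
    simp [diffAt, hd', hl, hR] at h₁
    simp [diffAt, hl]
    exact Or.inl ⟨h₁, rfl, rfl⟩

end RealRAM

/-! ### The grid of the cost bounds -/

namespace ARECInstance

variable {n : ℕ} (I : ARECInstance n)

/-- The indicator of the first-stage solution. -/
def mark (i : Fin n) : ℕ := if i ∈ I.X then 1 else 0

/-- A sorted grid that contains all cost bounds. -/
structure IsGrid (N : ℕ) (z : ℕ → ℝ) : Prop where
  two_le : 2 ≤ N
  mono : GridMono z N
  le_lo : ∀ i, z 0 ≤ I.lo i
  hi_le : ∀ i, I.hi i ≤ z (N - 1)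
  inLo : GridConcave z N (I.dualIn I.lo)
  inHi : GridConcave z N (I.dualIn I.hi)
  outLo : GridConcave z N (I.dualOut I.lo)
  outHi : GridConcave z N (I.dualOut I.hi)

/-- The keys `z` with tags `T` are a rearrangement of the cost bounds, the lower ones with the indicator
of `X` as tag and the upper ones with a tag larger by two. -/
def IsRearrangement (z : ℕ → ℝ) (T : ℕ → ℕ) : Prop :=
  ∀ g, RealRAM.pairSum z T g (n + n) =
    ∑ i, g (I.lo i) (I.mark i) + ∑ i, g (I.hi i) (I.mark i + 2)

variable {I} {z : ℕ → ℝ} {T : ℕ → ℕ}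

theorem IsRearrangement.tagBend (h : I.IsRearrangement z T) (τ : ℕ) (κ u : ℝ) :
    tagBend z T (n + n) τ κ u = κ * u - (∑ i, (if I.mark i = τ then max 0 (u - I.lo i) else 0) +
      ∑ i, if I.mark i + 2 = τ then max 0 (u - I.hi i) else 0) := by
  unfold _root_.tagBend bend
  rw [Finset.sum_filter]
  congr 1
  exact h fun k τ' => if τ' = τ then max 0 (u - k) else 0

theorem sum_compl_eq {ι : Type*} [Fintype ι] [DecidableEq ι] (S : Finset ι) (f : ι → ℝ) :
    ∑ i ∈ Sᶜ, f i = ∑ i, if i ∈ S then 0 else f i := by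
  rw [← Finset.sum_add_sum_compl S fun i => if i ∈ S then 0 else f i,
    Finset.sum_eq_zero fun i hi => if_pos hi, zero_add]
  exact Finset.sum_congr rfl fun i hi => (if_neg (Finset.mem_compl.1 hi)).symm

theorem IsRearrangement.inLo (h : I.IsRearrangement z T) :
    _root_.tagBend z T (n + n) 1 (I.p - I.k) = I.dualIn I.lo := by
  funext u
  rw [h.tagBend, dualIn, bend]
  simp [mark]

theorem IsRearrangement.inHi (h : I.IsRearrangement z T) :
    _root_.tagBend z T (n + n) 3 (I.p - I.k) = I.dualIn I.hi := by
  funext u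
  have (i : Fin n) : I.mark i ≠ 3 := by unfold mark; split_ifs <;> simp
  rw [h.tagBend, dualIn, bend]
  simp [this]
  simp [mark]

theorem IsRearrangement.outLo (h : I.IsRearrangement z T) :
    _root_.tagBend z T (n + n) 0 I.k = I.dualOut I.lo := by
  funext u
  rw [h.tagBend, dualOut, bend]
  simp [mark, sum_compl_eq]

theorem IsRearrangement.outHi (h : I.IsRearrangement z T) :
    _root_.tagBend z T (n + n) 2 I.k = I.dualOut I.hi := by
  funext u
  have (i : Fin n) : I.mark i ≠ 2 := by unfold mark; split_ifs <;> simp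
  rw [h.tagBend, dualOut, bend]
  simp [this]
  simp [mark, sum_compl_eq]

theorem n_pos (I : ARECInstance n) : 1 ≤ n := I.one_le_p.trans I.p_le_n

theorem IsRearrangement.isGrid (h : I.IsRearrangement z T) (hz : GridMono z (n + n)) :
    I.IsGrid (n + n) z := by
  have hn := I.n_pos
  have hle (i : Fin n) : z 0 ≤ I.lo i := by
    have h₁ := h fun k _ => if k < z 0 then 1 else 0
    have h₂ : RealRAM.pairSum z T (fun k _ => if k < z 0 then 1 else 0) (n + n) = 0 := by
      refine Finset.sum_eq_zero fun x hx => if_neg ?_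
      exact not_lt.2 (hz 0 x (Nat.zero_le _) (Finset.mem_range.1 hx))
    have h₃ : (0 : ℝ) ≤ ∑ i, if I.hi i < z 0 then 1 else 0 :=
      Finset.sum_nonneg fun i _ => by split_ifs <;> simp
    by_contra! hlt
    have h₄ := Finset.single_le_sum (f := fun i => if I.lo i < z 0 then (1 : ℝ) else 0)
      (fun i _ => by split_ifs <;> simp) (Finset.mem_univ i)
    simp only [if_pos hlt] at h₄
    linarith
  have hge (i : Fin n) : I.hi i ≤ z (n + n - 1) := by
    have h₁ := h fun k _ => if z (n + n - 1) < k then 1 else 0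
    have h₂ : RealRAM.pairSum z T (fun k _ => if z (n + n - 1) < k then 1 else 0) (n + n) = 0 := by
      refine Finset.sum_eq_zero fun x hx => if_neg ?_
      have := Finset.mem_range.1 hx
      exact not_lt.2 (hz x _ (by omega) (by omega))
    have h₃ : (0 : ℝ) ≤ ∑ i, if z (n + n - 1) < I.lo i then 1 else 0 :=
      Finset.sum_nonneg fun i _ => by split_ifs <;> simp
    by_contra! hlt
    have h₄ := Finset.single_le_sum (f := fun i => if z (n + n - 1) < I.hi i then (1 : ℝ) else 0)
      (fun i _ => by split_ifs <;> simp) (Finset.mem_univ i)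
    simp only [if_pos hlt] at h₄
    linarith
  exact ⟨by omega, hz, hle, hge, h.inLo ▸ gridConcave_tagBend hz T 1 _,
    h.inHi ▸ gridConcave_tagBend hz T 3 _, h.outLo ▸ gridConcave_tagBend hz T 0 _,
    h.outHi ▸ gridConcave_tagBend hz T 2 _⟩

/-- The indices `i` and `j` are the first grid maximizers of `f` and `g`. -/
def AreArgmax (z : ℕ → ℝ) (N : ℕ) (f g : ℝ → ℝ) (i j : ℕ) : Prop :=
  (i < N ∧ (∀ t < N, f (z t) ≤ f (z i)) ∧ ∀ t < i, f (z t) < f (z i)) ∧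
    (j < N ∧ (∀ t < N, g (z t) ≤ g (z j)) ∧ ∀ t < j, g (z t) < g (z j))

/-- Since the difference of the functions is monotone, the maximizers are ordered, so that there is a
range between them to search. -/
theorem AreArgmax.le {N i j : ℕ} {f g : ℝ → ℝ} (h : AreArgmax z N f g i j) (hz : GridMono z N)
    (hmono : Monotone fun u => g u - f u) : i ≤ j := by
  obtain ⟨⟨hi, -, hi'⟩, -, hj, -⟩ := h
  by_contra! hlt
  have h₁ := hi' j hlt
  have h₂ : g (z j) - f (z j) ≤ g (z i) - f (z i) := hmono (hz j i hlt.le hi)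
  have h₃ := hj i hi
  linarith

variable {N : ℕ}

theorem bound_eq (I : ARECInstance n) (u v : ℝ) :
    I.bound u v = min ((I.Γ + I.dualIn I.lo u) + I.dualOut I.lo v)
      (I.dualIn I.hi u + I.dualOut I.hi v) := by
  rw [bound, dual, dual, add_assoc]

theorem bound_eq' (I : ARECInstance n) (u v : ℝ) :
    I.bound u v = min ((I.Γ + I.dualOut I.lo v) + I.dualIn I.lo u)
      (I.dualOut I.hi v + I.dualIn I.hi u) := by
  rw [bound, dual, dual]
  congr 1 <;> ring

/-- The best multiplier `v` for a multiplier `u` on the grid. -/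
theorem IsGrid.best_out (h : I.IsGrid N z) {i j t : ℕ}
    (hij : AreArgmax z N (I.dualOut I.lo) (I.dualOut I.hi) i j) (ht : t < N) {w : ℝ}
    (hw : Crossing I.spendOut (z (min i t)) (z (min j t))
      (I.Γ + I.dualIn I.lo (z t) - I.dualIn I.hi (z t)) w) :
    z 0 ≤ w ∧ w ≤ z t ∧ ∀ v, z 0 ≤ v → v ≤ z t → I.bound (z t) v ≤ I.bound (z t) w := by
  have hle := hij.le h.mono I.spendOut_mono
  obtain ⟨h₁, h₂⟩ := hw.mem (h.mono _ _ (by omega) (by omega))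
  have hm (r : ℕ) (hr : r ≤ t) : z 0 ≤ z r ∧ z r ≤ z t :=
    ⟨h.mono _ _ (Nat.zero_le _) (by omega), h.mono _ _ hr ht⟩
  refine ⟨(hm _ (min_le_right _ _)).1.trans h₁, h₂.trans (hm _ (min_le_right _ _)).2,
    fun v hv₀ hv => ?_⟩
  rw [bound_eq, bound_eq]
  exact Crossing.min_le h.outLo.concave h.outHi.concave (hm _ (min_le_right _ _))
    (hm _ (min_le_right _ _))
    (fun v h₀ h₁ => h.outLo.le_min_index h.mono h.two_le ht hij.1.1 hij.1.2.1 h₀ h₁)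
    (fun v h₀ h₁ => h.outHi.le_min_index h.mono h.two_le ht hij.2.1 hij.2.2.1 h₀ h₁) hw hv₀ hv

/-- The best multiplier `u` for a multiplier `v` on the grid. -/
theorem IsGrid.best_in (h : I.IsGrid N z) {i j t : ℕ}
    (hij : AreArgmax z N (I.dualIn I.lo) (I.dualIn I.hi) i j) (ht : t < N) {w : ℝ}
    (hw : Crossing I.spendIn (z (max i t)) (z (max j t))
      (I.Γ + I.dualOut I.lo (z t) - I.dualOut I.hi (z t)) w) :
    z t ≤ w ∧ w ≤ z (N - 1) ∧
      ∀ u, z t ≤ u → u ≤ z (N - 1) → I.bound u (z t) ≤ I.bound w (z t) := by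
  have hle := hij.le h.mono I.spendIn_mono
  have hi := hij.1.1
  have hj := hij.2.1
  obtain ⟨h₁, h₂⟩ := hw.mem (h.mono _ _ (by omega) (by omega))
  have hm (r : ℕ) (hr : t ≤ r) (hr' : r < N) : z t ≤ z r ∧ z r ≤ z (N - 1) :=
    ⟨h.mono _ _ hr hr', h.mono _ _ (by omega) (by omega)⟩
  refine ⟨(hm _ (le_max_right _ _) (by omega)).1.trans h₁,
    h₂.trans (hm _ (le_max_right _ _) (by omega)).2, fun v hv₀ hv => ?_⟩
  rw [bound_eq', bound_eq']
  exact Crossing.min_le h.inLo.concave h.inHi.concave (hm _ (le_max_right _ _) (by omega))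
    (hm _ (le_max_right _ _) (by omega))
    (fun v h₀ h₁ => h.inLo.le_max_index h.mono h.two_le ht hij.1.2.1 h₀ h₁)
    (fun v h₀ h₁ => h.inHi.le_max_index h.mono h.two_le ht hij.2.2.1 h₀ h₁) hw hv₀ hv

/-- The best pair of equal multipliers. -/
theorem IsGrid.best_diag (h : I.IsGrid N z) {i j : ℕ}
    (hij : AreArgmax z N (fun u => I.dualIn I.lo u + I.dualOut I.lo u)
      (fun u => I.dualIn I.hi u + I.dualOut I.hi u) i j) {w : ℝ}
    (hw : Crossing (fun u => (I.dualIn I.hi u + I.dualOut I.hi u) -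
      (I.dualIn I.lo u + I.dualOut I.lo u)) (z i) (z j) I.Γ w) :
    z 0 ≤ w ∧ w ≤ z (N - 1) ∧
      ∀ u, z 0 ≤ u → u ≤ z (N - 1) → I.bound u u ≤ I.bound w w := by
  have hle := hij.le h.mono I.spend_mono
  have hi := hij.1.1
  have hj := hij.2.1
  obtain ⟨h₁, h₂⟩ := hw.mem (h.mono _ _ hle hj)
  have hm (r : ℕ) (hr : r < N) : z 0 ≤ z r ∧ z r ≤ z (N - 1) :=
    ⟨h.mono _ _ (Nat.zero_le _) hr, h.mono _ _ (by omega) (by omega)⟩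
  refine ⟨(hm _ hi).1.trans h₁, h₂.trans (hm _ hj).2, fun v hv₀ hv => ?_⟩
  have e (u : ℝ) : I.bound u u = min (I.Γ + (I.dualIn I.lo u + I.dualOut I.lo u))
      (0 + (I.dualIn I.hi u + I.dualOut I.hi u)) := by
    rw [bound, dual, dual, zero_add]
  rw [e, e]
  exact Crossing.min_le (h.inLo.concave.add h.outLo.concave) (h.inHi.concave.add h.outHi.concave)
    (hm _ hi) (hm _ hj)
    (fun v h₀ h₁ => (h.inLo.add h.outLo).le_of_grid h.two_le hij.1.2.1 h₀ h₁)
    (fun v h₀ h₁ => (h.inHi.add h.outHi).le_of_grid h.two_le hij.2.2.1 h₀ h₁)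
    (by rwa [sub_zero]) hv₀ hv

/-- A pair of multipliers is optimal if no pair with a component on the grid and no pair of equal
multipliers is better. -/
theorem IsGrid.bound_le (h : I.IsGrid N z) {x : ℝ}
    (hin : ∀ t < N, ∀ v, z 0 ≤ v → v ≤ z t → I.bound (z t) v ≤ x)
    (hout : ∀ t < N, ∀ u, z t ≤ u → u ≤ z (N - 1) → I.bound u (z t) ≤ x)
    (hdiag : ∀ u, z 0 ≤ u → u ≤ z (N - 1) → I.bound u u ≤ x)
    {u v : ℝ} (hvu : v ≤ u) (hv : z 0 ≤ v) (hu : u ≤ z (N - 1)) : I.bound u v ≤ x := by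
  obtain ⟨u', v', h₁, h₂, h₃, h₄, h₅, h₆⟩ :=
    exists_le_of_grid h.two_le h.mono h.inLo h.inHi h.outLo h.outHi hvu hv hu
  have h₇ : I.bound u v ≤ I.bound u' v' := by
    unfold bound dual
    exact min_le_min (by linarith) h₅
  refine h₇.trans ?_
  rcases h₆ with ⟨t, ht, rfl⟩ | ⟨t, ht, rfl⟩ | rfl
  · exact hin t ht _ h₂ h₁
  · exact hout t ht _ h₁ h₃
  · exact hdiag _ h₂ h₃

/-- The level at which a given part of the budget is used up. -/
theorem _root_.Crossing.map_min {s : ℝ → ℝ} (hs : Monotone s) {a b R w v : ℝ} (hR : 0 ≤ R) (ha : s a = 0)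
    (hvb : v ≤ b) (hw : Crossing s a b R w) : s (min v w) = min (s v) R := by
  rw [hs.map_min]
  rcases hw with ⟨h, rfl⟩ | ⟨h, rfl⟩ | ⟨h, -⟩
  · rw [show s w = R by linarith]
  · rw [min_eq_left (hs hvb), min_eq_left ((hs hvb).trans h)]
  · rw [h]

end ARECInstance

/-! ### Loading the instance -/

namespace RealRAM

/-- Writes the cost bounds to the real array `3` and their tags to the natural array `1`: the tags are `0`
and `1` for the lower bounds outside and inside `X`, and `2` and `3` for the upper ones. -/
def collectBounds : Program :=
  .seq (.setNat 3 (.plus (.var 0) (.var 0))) <|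
  .forLoop 5 0 <|
    .seq (.writeReal 3 (.var 5) (.read 0 (.var 5))) <|
    .seq (.writeNat 1 (.var 5) (.read 0 (.var 5))) <|
    .seq (.writeReal 3 (.plus (.var 0) (.var 5)) (.plus (.read 0 (.var 5)) (.read 1 (.var 5)))) <|
    .writeNat 1 (.plus (.var 0) (.var 5)) (.plus (.read 0 (.var 5)) (.lit 2))

theorem runs_collectBounds {s : State} {n : ℕ} (hn : s.natVar 0 = n) :
    Runs collectBounds s fun t s' => t ≤ n * 60 + 20 ∧ s'.natVar 3 = n + n ∧
      ∀ i < n, s'.realArr 3 i = s.realArr 0 i ∧ s'.natArr 1 i = s.natArr 0 i ∧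
        s'.realArr 3 (n + i) = s.realArr 0 i + s.realArr 1 i ∧
        s'.natArr 1 (n + i) = s.natArr 0 i + 2 := by
  rw [collectBounds, runs_seq, runs_setNat]
  refine (Runs.forLoop (fun t s' => ∀ i < t, s'.realArr 3 i = s.realArr 0 i ∧
    s'.natArr 1 i = s.natArr 0 i ∧ s'.realArr 3 (n + i) = s.realArr 0 i + s.realArr 1 i ∧
    s'.natArr 1 (n + i) = s.natArr 0 i + 2) (B := 50) rfl rfl (by decide) (by simp) ?_).mono ?_
  · intro t s₁ ht h5 hf hJ
    have e0 : s₁.realArr 0 = s.realArr 0 := by rw [hf.realArr 0 rfl]; simp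
    have e1 : s₁.realArr 1 = s.realArr 1 := by rw [hf.realArr 1 rfl]; simp
    have eX : s₁.natArr 0 = s.natArr 0 := by rw [hf.natArr 0 rfl]; simp
    have en : s₁.natVar 0 = n := by rw [hf.natVar 0 rfl]; simpa using hn
    simp [hn] at ht
    simp [h5, e0, e1, eX, en]
    intro i hi
    rcases Nat.lt_or_eq_of_le hi with hi | rfl
    · obtain ⟨h₁, h₂, h₃, h₄⟩ := hJ i hi
      have a₁ : i ≠ n + t := by omega
      have a₂ : i ≠ t := by omega
      have a₃ : n + i ≠ n + t := by omega
      have a₄ : n + i ≠ t := by omega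
      simp only [Function.update_of_ne a₁, Function.update_of_ne a₂, Function.update_of_ne a₃,
        Function.update_of_ne a₄]
      exact ⟨h₁, h₂, h₃, h₄⟩
    · have a₁ : i ≠ n + i := by omega
      simp [Function.update_of_ne a₁]
  · rintro t s' ⟨ht, hJ, hf⟩
    have e3 : s'.natVar 3 = n + n := by rw [hf.natVar 3 rfl]; simp [hn]
    simp [hn] at ht hJ ⊢
    exact ⟨by omega, e3, hJ⟩

/-- Adds the tables of the two parts of the dual objective. -/
def addTables : Program :=
  .forLoop 5 3 <|
    .seq (.writeReal 9 (.var 5) (.plus (.read 5 (.var 5)) (.read 7 (.var 5)))) <|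
    .writeReal 10 (.var 5) (.plus (.read 6 (.var 5)) (.read 8 (.var 5)))

theorem runs_addTables {s : State} {N : ℕ} (hN : s.natVar 3 = N) :
    Runs addTables s fun t s' => t ≤ N * 40 + 20 ∧
      ∀ x < N, s'.realArr 9 x = s.realArr 5 x + s.realArr 7 x ∧
        s'.realArr 10 x = s.realArr 6 x + s.realArr 8 x := by
  refine (Runs.forLoop (fun t s' => ∀ x < t, s'.realArr 9 x = s.realArr 5 x + s.realArr 7 x ∧
    s'.realArr 10 x = s.realArr 6 x + s.realArr 8 x) (B := 30) rfl rfl (by decide) (by simp)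
    ?_).mono ?_
  · intro t s₁ ht h5 hf hJ
    have e5 := hf.realArr 5 rfl
    have e6 := hf.realArr 6 rfl
    have e7 := hf.realArr 7 rfl
    have e8 := hf.realArr 8 rfl
    simp [h5, e5, e6, e7, e8]
    intro i hi
    rcases Nat.lt_or_eq_of_le hi with hi | rfl
    · rw [Function.update_of_ne hi.ne, Function.update_of_ne hi.ne]
      exact hJ i hi
    · simp
  · rintro t s' ⟨ht, hJ, hf⟩
    rw [hN] at ht hJ
    exact ⟨by omega, hJ⟩

/-- Tabulates the dual objectives on the grid: the parts of the items in `X` and of the other items in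
the real arrays `5`, `6` and `7`, `8`, and their sums in `9`, `10`, each time first for the lower and
then for the upper cost bounds. -/
def fillTables : Program :=
  .seq (tabulate 1 (.minus (.var 1) (.var 2)) 5) <|
  .seq (tabulate 3 (.minus (.var 1) (.var 2)) 6) <|
  .seq (tabulate 0 (.var 2) 7) <|
  .seq (tabulate 2 (.var 2) 8) addTables

theorem runs_fillTables {s : State} {N : ℕ} {z : ℕ → ℝ} {T : ℕ → ℕ} {κ κ' : ℕ}
    (hN : s.natVar 3 = N) (hN0 : 0 < N) (hz' : s.realArr 3 = z) (hz : GridMono z N)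
    (hT : s.natArr 1 = T) (hκ : s.natVar 1 - s.natVar 2 = κ) (hκ' : s.natVar 2 = κ') :
    Runs fillTables s fun t s' => t ≤ N * 280 + 120 ∧ ∀ x < N,
      s'.realArr 5 x = tagBend z T N 1 κ (z x) ∧ s'.realArr 6 x = tagBend z T N 3 κ (z x) ∧
      s'.realArr 7 x = tagBend z T N 0 κ' (z x) ∧ s'.realArr 8 x = tagBend z T N 2 κ' (z x) ∧
      s'.realArr 9 x = tagBend z T N 1 κ (z x) + tagBend z T N 0 κ' (z x) ∧
      s'.realArr 10 x = tagBend z T N 3 κ (z x) + tagBend z T N 2 κ' (z x) := by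
  rw [fillTables, runs_seq]
  refine (runs_tabulate (by decide) hN hN0 (hz'.symm ▸ hz)).frame.mono ?_
  rintro t₁ s₁ ⟨⟨ht₁, h₁⟩, hf₁⟩
  rw [hz', hT] at h₁
  have hN₁ : s₁.natVar 3 = N := (hf₁.natVar 3 rfl).trans hN
  have hz₁ : s₁.realArr 3 = z := (hf₁.realArr 3 rfl).trans hz'
  have hT₁ : s₁.natArr 1 = T := (hf₁.natArr 1 rfl).trans hT
  have hp₁ : s₁.natVar 1 = s.natVar 1 := hf₁.natVar 1 rfl
  have hk₁ : s₁.natVar 2 = s.natVar 2 := hf₁.natVar 2 rfl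
  rw [runs_seq]
  refine (runs_tabulate (by decide) hN₁ hN0 (hz₁.symm ▸ hz)).frame.mono ?_
  rintro t₂ s₂ ⟨⟨ht₂, h₂⟩, hf₂⟩
  rw [hz₁, hT₁] at h₂
  have hN₂ : s₂.natVar 3 = N := (hf₂.natVar 3 rfl).trans hN₁
  have hz₂ : s₂.realArr 3 = z := (hf₂.realArr 3 rfl).trans hz₁
  have hT₂ : s₂.natArr 1 = T := (hf₂.natArr 1 rfl).trans hT₁
  have hk₂ : s₂.natVar 2 = s.natVar 2 := (hf₂.natVar 2 rfl).trans hk₁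
  rw [runs_seq]
  refine (runs_tabulate (by decide) hN₂ hN0 (hz₂.symm ▸ hz)).frame.mono ?_
  rintro t₃ s₃ ⟨⟨ht₃, h₃⟩, hf₃⟩
  rw [hz₂, hT₂] at h₃
  have hN₃ : s₃.natVar 3 = N := (hf₃.natVar 3 rfl).trans hN₂
  have hz₃ : s₃.realArr 3 = z := (hf₃.realArr 3 rfl).trans hz₂
  have hT₃ : s₃.natArr 1 = T := (hf₃.natArr 1 rfl).trans hT₂
  have hk₃ : s₃.natVar 2 = s.natVar 2 := (hf₃.natVar 2 rfl).trans hk₂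
  rw [runs_seq]
  refine (runs_tabulate (by decide) hN₃ hN0 (hz₃.symm ▸ hz)).frame.mono ?_
  rintro t₄ s₄ ⟨⟨ht₄, h₄⟩, hf₄⟩
  rw [hz₃, hT₃] at h₄
  refine (runs_addTables ((hf₄.natVar 3 rfl).trans hN₃)).frame.mono ?_
  rintro t₅ s₅ ⟨⟨ht₅, h₅⟩, hf₅⟩
  have e5 : s₄.realArr 5 = s₁.realArr 5 :=
    (hf₄.realArr 5 rfl).trans ((hf₃.realArr 5 rfl).trans (hf₂.realArr 5 rfl))
  have e6 : s₄.realArr 6 = s₂.realArr 6 := (hf₄.realArr 6 rfl).trans (hf₃.realArr 6 rfl)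
  have e7 : s₄.realArr 7 = s₃.realArr 7 := hf₄.realArr 7 rfl
  simp [hp₁, hk₁, hκ] at h₁ h₂ ht₁ ht₂
  simp [hk₂, hk₃, hκ'] at h₃ h₄ ht₃ ht₄
  refine ⟨by omega, fun x hx => ?_⟩
  obtain ⟨h₉, h₁₀⟩ := h₅ x hx
  rw [hf₅.realArr 5 rfl, hf₅.realArr 6 rfl, hf₅.realArr 7 rfl, hf₅.realArr 8 rfl, h₉, h₁₀, e5, e6,
    e7, h₁ x hx, h₂ x hx, h₃ x hx, h₄ x hx]
  exact ⟨rfl, rfl, rfl, rfl, rfl, rfl⟩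

/-- Maximizes the six tables. -/
def findArgmaxes : Program :=
  .seq (argmax 5 10) <| .seq (argmax 6 11) <| .seq (argmax 7 12) <| .seq (argmax 8 13) <|
  .seq (argmax 9 14) (argmax 10 15)

/-- The index `v` is the first one below `N` with the largest value of `f`. -/
def IsArgmax (f : ℕ → ℝ) (N v : ℕ) : Prop :=
  v < N ∧ (∀ x < N, f x ≤ f v) ∧ ∀ x < v, f x < f v

theorem runs_findArgmaxes {s : State} {N : ℕ} (hN : s.natVar 3 = N) (hN0 : 0 < N) :
    Runs findArgmaxes s fun t s' => t ≤ N * 120 + 120 ∧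
      IsArgmax (s.realArr 5) N (s'.natVar 10) ∧ IsArgmax (s.realArr 6) N (s'.natVar 11) ∧
      IsArgmax (s.realArr 7) N (s'.natVar 12) ∧ IsArgmax (s.realArr 8) N (s'.natVar 13) ∧
      IsArgmax (s.realArr 9) N (s'.natVar 14) ∧ IsArgmax (s.realArr 10) N (s'.natVar 15) := by
  have step {s₁ : State} (a v : ℕ) (h3 : s₁.natVar 3 = N) (hr : s₁.realArr = s.realArr)
      (hv3 : v ≠ 3) (hv5 : v ≠ 5) :
      Runs (argmax a v) s₁ fun t s' => (t ≤ N * 20 + 20 ∧ IsArgmax (s.realArr a) N (s'.natVar v) ∧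
        s'.natVar 3 = N ∧ s'.realArr = s.realArr) ∧
        ∀ w, w ≠ v → w ≠ 5 → s'.natVar w = s₁.natVar w := by
    refine (runs_argmax hv3 hv5 h3 hN0).frame.mono ?_
    rintro t s' ⟨⟨h₁, h₂, h₃⟩, hf⟩
    have hw (w : ℕ) (h : w ≠ v) (h5 : w ≠ 5) : s'.natVar w = s₁.natVar w :=
      hf.natVar w (by simp [argmax, Program.forLoop, Program.setsNat, Ne.symm h, Ne.symm h5])
    rw [hr] at h₃
    exact ⟨⟨h₁, ⟨h₂, h₃⟩, (hw 3 (Ne.symm hv3) (by decide)).trans h3,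
      (funext fun b => hf.realArr b rfl).trans hr⟩, hw⟩
  rw [findArgmaxes, runs_seq]
  refine (step 5 10 hN rfl (by decide) (by decide)).mono ?_
  rintro t₁ s₁ ⟨⟨h₁, m₁, n₁, r₁⟩, -⟩
  rw [runs_seq]
  refine (step 6 11 n₁ r₁ (by decide) (by decide)).mono ?_
  rintro t₂ s₂ ⟨⟨h₂, m₂, n₂, r₂⟩, w₂⟩
  rw [runs_seq]
  refine (step 7 12 n₂ r₂ (by decide) (by decide)).mono ?_
  rintro t₃ s₃ ⟨⟨h₃, m₃, n₃, r₃⟩, w₃⟩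
  rw [runs_seq]
  refine (step 8 13 n₃ r₃ (by decide) (by decide)).mono ?_
  rintro t₄ s₄ ⟨⟨h₄, m₄, n₄, r₄⟩, w₄⟩
  rw [runs_seq]
  refine (step 9 14 n₄ r₄ (by decide) (by decide)).mono ?_
  rintro t₅ s₅ ⟨⟨h₅, m₅, n₅, r₅⟩, w₅⟩
  refine (step 10 15 n₅ r₅ (by decide) (by decide)).mono ?_
  rintro t₆ s₆ ⟨⟨h₆, m₆, n₆, r₆⟩, w₆⟩
  refine ⟨by omega, ?_, ?_, ?_, ?_, ?_, m₆⟩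
  · rwa [w₆ 10 (by decide) (by decide), w₅ 10 (by decide) (by decide),
      w₄ 10 (by decide) (by decide), w₃ 10 (by decide) (by decide), w₂ 10 (by decide) (by decide)]
  · rwa [w₆ 11 (by decide) (by decide), w₅ 11 (by decide) (by decide),
      w₄ 11 (by decide) (by decide), w₃ 11 (by decide) (by decide)]
  · rwa [w₆ 12 (by decide) (by decide), w₅ 12 (by decide) (by decide),
      w₄ 12 (by decide) (by decide)]
  · rwa [w₆ 13 (by decide) (by decide), w₅ 13 (by decide) (by decide)]
  · rwa [w₆ 14 (by decide) (by decide)]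

/-- Prepares all tables. -/
def load : Program :=
  .seq collectBounds <| .seq mergeSort <| .seq fillTables findArgmaxes

/-- The tables for the instance `I` are in the memory. -/
structure Loaded {n : ℕ} (I : ARECInstance n) (N : ℕ) (z : ℕ → ℝ) (s : State) : Prop where
  items : s.natVar 0 = n
  points : s.natVar 3 = N
  budget : s.realVar 0 = I.Γ
  mark : ∀ i : Fin n, s.natArr 0 i = I.mark i
  lo : ∀ i : Fin n, s.realArr 0 i = I.lo i
  dev : ∀ i : Fin n, s.realArr 1 i = I.d i
  grid : s.realArr 3 = z
  inLo : ∀ t < N, s.realArr 5 t = I.dualIn I.lo (z t)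
  inHi : ∀ t < N, s.realArr 6 t = I.dualIn I.hi (z t)
  outLo : ∀ t < N, s.realArr 7 t = I.dualOut I.lo (z t)
  outHi : ∀ t < N, s.realArr 8 t = I.dualOut I.hi (z t)
  sumLo : ∀ t < N, s.realArr 9 t = I.dualIn I.lo (z t) + I.dualOut I.lo (z t)
  sumHi : ∀ t < N, s.realArr 10 t = I.dualIn I.hi (z t) + I.dualOut I.hi (z t)
  argIn : ARECInstance.AreArgmax z N (I.dualIn I.lo) (I.dualIn I.hi) (s.natVar 10) (s.natVar 11)
  argOut : ARECInstance.AreArgmax z N (I.dualOut I.lo) (I.dualOut I.hi) (s.natVar 12) (s.natVar 13)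
  argSum : ARECInstance.AreArgmax z N (fun u => I.dualIn I.lo u + I.dualOut I.lo u)
    (fun u => I.dualIn I.hi u + I.dualOut I.hi u) (s.natVar 14) (s.natVar 15)

theorem isRearrangement_of_collected {n : ℕ} {I : ARECInstance n} {K : ℕ → ℝ} {T : ℕ → ℕ}
    (h : ∀ i : Fin n, K i = I.lo i ∧ T i = I.mark i ∧ K (n + i) = I.hi i ∧
      T (n + i) = I.mark i + 2) : I.IsRearrangement K T := by
  intro g
  rw [pairSum, Finset.sum_range_add, Finset.sum_range, Finset.sum_range]
  congr 1 <;> refine Finset.sum_congr rfl fun i _ => ?_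
  · rw [(h i).1, (h i).2.1]
  · rw [(h i).2.2.1, (h i).2.2.2]

theorem IsArgmax.of_table {f : ℕ → ℝ} {N v : ℕ} (h : IsArgmax f N v) {z : ℕ → ℝ} {g : ℝ → ℝ}
    (hfg : ∀ t < N, f t = g (z t)) :
    v < N ∧ (∀ t < N, g (z t) ≤ g (z v)) ∧ ∀ t < v, g (z t) < g (z v) := by
  obtain ⟨h₁, h₂, h₃⟩ := h
  refine ⟨h₁, fun t ht => ?_, fun t ht => ?_⟩
  · rw [← hfg t ht, ← hfg v h₁]
    exact h₂ t ht
  · rw [← hfg t (ht.trans h₁), ← hfg v h₁]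
    exact h₃ t ht

theorem runs_load {n : ℕ} (I : ARECInstance n) :
    Runs load I.input fun t s => t ≤ (Nat.log 2 (n + n) + 1) * ((n + n) * 106 + 30) +
      (n + n) * 460 + 300 ∧ ∃ z, I.IsGrid (n + n) z ∧ Loaded I (n + n) z s := by
  have hn := I.n_pos
  rw [load, runs_seq]
  refine (runs_collectBounds (n := n) rfl).frame.mono ?_
  rintro t₁ s₁ ⟨⟨ht₁, h3₁, hk₁⟩, hf₁⟩
  have hre : I.IsRearrangement (s₁.realArr 3) (s₁.natArr 1) := by
    refine isRearrangement_of_collected fun i => ?_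
    obtain ⟨h₁, h₂, h₃, h₄⟩ := hk₁ i i.2
    rw [h₁, h₂, h₃, h₄]
    simp [ARECInstance.input, ARECInstance.mark, ARECInstance.hi]
  rw [runs_seq]
  refine (runs_mergeSort s₁).frame.mono ?_
  rintro t₂ s₂ ⟨⟨ht₂, hmono, hsum⟩, hf₂⟩
  rw [h3₁] at ht₂ hmono hsum
  have hre₂ : I.IsRearrangement (s₂.realArr 3) (s₂.natArr 1) := fun g => by rw [hsum, hre]
  have h3₂ : s₂.natVar 3 = n + n := (hf₂.natVar 3 rfl).trans h3₁
  have hp : s₂.natVar 1 = I.p := (hf₂.natVar 1 rfl).trans (hf₁.natVar 1 rfl)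
  have hk : s₂.natVar 2 = I.k := (hf₂.natVar 2 rfl).trans (hf₁.natVar 2 rfl)
  rw [runs_seq]
  refine (runs_fillTables h3₂ (by omega) rfl hmono rfl (by rw [hp, hk]) hk).frame.mono ?_
  rintro t₃ s₃ ⟨⟨ht₃, htab⟩, hf₃⟩
  have h3₃ : s₃.natVar 3 = n + n := (hf₃.natVar 3 rfl).trans h3₂
  refine (runs_findArgmaxes h3₃ (by omega)).frame.mono ?_
  rintro t₄ s₄ ⟨⟨ht₄, a₁, a₂, a₃, a₄, a₅, a₆⟩, hf₄⟩
  rw [Nat.cast_sub I.k_le_p] at htab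
  simp only [hre₂.inLo, hre₂.inHi, hre₂.outLo, hre₂.outHi] at htab
  refine ⟨by omega, s₂.realArr 3, hre₂.isGrid hmono, ?_⟩
  have hr (a : ℕ) : s₄.realArr a = s₃.realArr a := hf₄.realArr a rfl
  have hi0 : s₄.realArr 0 = I.input.realArr 0 := (hr 0).trans ((hf₃.realArr 0 rfl).trans
    ((hf₂.realArr 0 rfl).trans (hf₁.realArr 0 rfl)))
  have hi1 : s₄.realArr 1 = I.input.realArr 1 := (hr 1).trans ((hf₃.realArr 1 rfl).trans
    ((hf₂.realArr 1 rfl).trans (hf₁.realArr 1 rfl)))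
  have hX : s₄.natArr 0 = I.input.natArr 0 := (hf₄.natArr 0 rfl).trans ((hf₃.natArr 0 rfl).trans
    ((hf₂.natArr 0 rfl).trans (hf₁.natArr 0 rfl)))
  exact
    { items := (hf₄.natVar 0 rfl).trans ((hf₃.natVar 0 rfl).trans
        ((hf₂.natVar 0 rfl).trans (hf₁.natVar 0 rfl)))
      points := (hf₄.natVar 3 rfl).trans h3₃
      budget := (hf₄.realVar 0 rfl).trans ((hf₃.realVar 0 rfl).trans
        ((hf₂.realVar 0 rfl).trans (hf₁.realVar 0 rfl)))
      mark := fun i => by rw [hX]; simp [ARECInstance.input, ARECInstance.mark]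
      lo := fun i => by rw [hi0]; simp [ARECInstance.input]
      dev := fun i => by rw [hi1]; simp [ARECInstance.input]
      grid := (hr 3).trans (hf₃.realArr 3 rfl)
      inLo := fun t ht => by rw [hr]; exact (htab t ht).1
      inHi := fun t ht => by rw [hr]; exact (htab t ht).2.1
      outLo := fun t ht => by rw [hr]; exact (htab t ht).2.2.1
      outHi := fun t ht => by rw [hr]; exact (htab t ht).2.2.2.1
      sumLo := fun t ht => by rw [hr]; exact (htab t ht).2.2.2.2.1
      sumHi := fun t ht => by rw [hr]; exact (htab t ht).2.2.2.2.2
      argIn := ⟨a₁.of_table fun t ht => (htab t ht).1, a₂.of_table fun t ht => (htab t ht).2.1⟩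
      argOut := ⟨a₃.of_table fun t ht => (htab t ht).2.2.1,
        a₄.of_table fun t ht => (htab t ht).2.2.2.1⟩
      argSum := ⟨a₅.of_table (g := fun u => I.dualIn I.lo u + I.dualOut I.lo u)
          fun t ht => (htab t ht).2.2.2.2.1,
        a₆.of_table (g := fun u => I.dualIn I.hi u + I.dualOut I.hi u)
          fun t ht => (htab t ht).2.2.2.2.2⟩ }

end RealRAM

/-! ### Searching for optimal multipliers -/

namespace RealRAM

/-- The program changes none of the data of a loaded instance. -/
def Program.KeepsLoaded (P : Program) : Prop :=
  (∀ v ∈ [0, 3, 10, 11, 12, 13, 14, 15], P.setsNat v = false) ∧ P.setsReal 0 = false ∧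
    P.writesNat 0 = false ∧ ∀ a ∈ [0, 1, 3, 5, 6, 7, 8, 9, 10], P.writesReal a = false

instance (P : Program) : Decidable P.KeepsLoaded := by
  unfold Program.KeepsLoaded
  infer_instance

section
variable {n : ℕ} {I : ARECInstance n} {N : ℕ} {z : ℕ → ℝ} {s : State}

theorem Loaded.frame (h : Loaded I N z s) {P : Program} {s' : State} (hf : Frame P s s')
    (hP : P.KeepsLoaded) : Loaded I N z s' := by
  obtain ⟨h₁, h₂, h₃, h₄⟩ := hP
  have hn (v : ℕ) (hv : v ∈ [0, 3, 10, 11, 12, 13, 14, 15]) := hf.natVar v (h₁ v hv)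
  have ha (a : ℕ) (hv : a ∈ [0, 1, 3, 5, 6, 7, 8, 9, 10]) := hf.realArr a (h₄ a hv)
  obtain ⟨g₁, g₂, g₃, g₄, g₅, g₆, g₇, g₈, g₉, g₁₀, g₁₁, g₁₂, g₁₃, g₁₄, g₁₅, g₁₆⟩ := h
  refine ⟨?_, ?_, ?_, ?_, ?_, ?_, ?_, ?_, ?_, ?_, ?_, ?_, ?_, ?_, ?_, ?_⟩
  · rwa [hn 0 (by simp)]
  · rwa [hn 3 (by simp)]
  · rwa [hf.realVar 0 h₂]
  · rwa [hf.natArr 0 h₃]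
  · rwa [ha 0 (by simp)]
  · rwa [ha 1 (by simp)]
  · rwa [ha 3 (by simp)]
  · rwa [ha 5 (by simp)]
  · rwa [ha 6 (by simp)]
  · rwa [ha 7 (by simp)]
  · rwa [ha 8 (by simp)]
  · rwa [ha 9 (by simp)]
  · rwa [ha 10 (by simp)]
  · rwa [hn 10 (by simp), hn 11 (by simp)]
  · rwa [hn 12 (by simp), hn 13 (by simp)]
  · rwa [hn 14 (by simp), hn 15 (by simp)]

/-- The entry of the real array `a` at the index in the natural variable `v`, moved towards the next one
by the fraction in the real variable `w`. -/
def interp (a v w : ℕ) : RealExpr :=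
  .plus (.read a (.var v)) (.times (.var w)
    (.minus (.read a (.plus (.var v) (.lit 1))) (.read a (.var v))))

/-- The value of the sequence `f` at the index `j`, moved towards the next one by the fraction `θ`. -/
def place (f : ℕ → ℝ) (j : ℕ) (θ : ℝ) : ℝ := f j + θ * (f (j + 1) - f j)

@[simp] theorem interp_eval (a v w : ℕ) :
    (interp a v w).eval s = place (s.realArr a) (s.natVar v) (s.realVar w) := rfl

@[simp] theorem interp_cost (a v w : ℕ) : (interp a v w).cost = 12 := rfl

/-- The pair of `j` and `θ` denotes a place on a grid with `N` points. -/
def IsPlace (N j : ℕ) (θ : ℝ) : Prop := j < N ∧ (θ = 0 ∨ j + 1 < N) ∧ 0 ≤ θ ∧ θ ≤ 1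

theorem isPlace_zero {j : ℕ} (h : j < N) : IsPlace N j 0 := ⟨h, Or.inl rfl, le_rfl, zero_le_one⟩

theorem place_zero (f : ℕ → ℝ) (j : ℕ) : place f j 0 = f j := by simp [place]

theorem place_table {f : ℝ → ℝ} (hf : GridConcave z N f) (hz : GridMono z N) {F : ℕ → ℝ}
    (hF : ∀ t < N, F t = f (z t)) {j : ℕ} {θ : ℝ} (hj : IsPlace N j θ) :
    place F j θ = f (place z j θ) := by
  obtain ⟨h₁, h₂, h₃, h₄⟩ := hj
  rw [place, place, hf.interpolate hz h₂ h₃ h₄]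
  rcases h₂ with rfl | h₂
  · rw [hF j h₁]; simp
  · rw [hF j h₁, hF _ h₂]

/-- What `locate` finds in two tables is a crossing of the tabulated functions. -/
theorem Located.crossing {f g : ℝ → ℝ} (hf : GridConcave z N f) (hg : GridConcave z N g)
    (hz : GridMono z N) {F G : ℕ → ℝ} (hF : ∀ t < N, F t = f (z t)) (hG : ∀ t < N, G t = g (z t))
    {l r j : ℕ} {R θ : ℝ} (hlr : l ≤ r) (hr : r < N)
    (h : Located (fun x => G x - F x) l r R j θ) :
    IsPlace N j θ ∧ Crossing (fun u => g u - f u) (z l) (z r) R (place z j θ) := by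
  rcases h with ⟨h, rfl, rfl⟩ | ⟨h, rfl, rfl⟩ | ⟨h, h₁, h₂, h₃, h₄⟩
  · refine ⟨isPlace_zero (hlr.trans_lt hr), Or.inl ⟨?_, place_zero _ _⟩⟩
    beta_reduce
    rw [place_zero, ← hF _ (hlr.trans_lt hr), ← hG _ (hlr.trans_lt hr)]
    exact h
  · refine ⟨isPlace_zero hr, Or.inr (Or.inl ⟨?_, place_zero _ _⟩)⟩
    beta_reduce
    rw [place_zero, ← hF _ hr, ← hG _ hr]
    exact h
  · have hp : IsPlace N j θ := ⟨by omega, Or.inr (by omega), h₃, h₄⟩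
    refine ⟨hp, Or.inr (Or.inr ⟨?_, ?_, ?_⟩)⟩
    · beta_reduce
      rw [← place_table hf hz hF hp, ← place_table hg hz hG hp, ← h]
      unfold place
      ring
    · have e₁ := hz l j h₁ (by omega)
      have e₂ := mul_nonneg h₃ (sub_nonneg.2 (hz j (j + 1) (by omega) (by omega)))
      unfold place
      linarith
    · have e₁ := hz (j + 1) r h₂ hr
      have e₂ := mul_le_mul_of_nonneg_right h₄ (sub_nonneg.2 (hz j (j + 1) (by omega) (by omega)))
      unfold place
      linarith

/-- Computes the bound for the multipliers at the places given by the natural variable `20` and the real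
variable `13`, and by the natural variable `21` and the real variable `14`. -/
def evaluate : Program :=
  .seq (.setReal 9 (.plus (.var 0) (.plus (interp 5 20 13) (interp 7 21 14)))) <|
  .seq (.setReal 10 (.plus (interp 6 20 13) (interp 8 21 14))) <|
  .cond (.realLt (.var 10) (.var 9)) (.setReal 9 (.var 10)) .skip

theorem runs_evaluate (hL : Loaded I N z s) (hz : I.IsGrid N z)
    (hu : IsPlace N (s.natVar 20) (s.realVar 13)) (hv : IsPlace N (s.natVar 21) (s.realVar 14)) :
    Runs evaluate s fun t s' => t ≤ 70 ∧ s'.realVar 9 =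
      I.bound (place z (s.natVar 20) (s.realVar 13)) (place z (s.natVar 21) (s.realVar 14)) := by
  simp [evaluate, hL.budget, place_table hz.inLo hz.mono hL.inLo hu,
    place_table hz.inHi hz.mono hL.inHi hu, place_table hz.outLo hz.mono hL.outLo hv,
    place_table hz.outHi hz.mono hL.outHi hv]
  constructor
  · intro h
    exact (min_eq_right h.le).symm
  · intro h
    exact (min_eq_left h).symm

/-- Stores the multipliers in the real variables `4` and `5`, their bound in `1`, and the part of the
budget spent outside `X` in `6`. -/
def record : Program :=
  .seq (.setReal 1 (.var 9)) <|
  .seq (.setReal 4 (interp 3 20 13)) <|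
  .seq (.setReal 5 (interp 3 21 14)) <|
  .setReal 6 (.minus (interp 8 21 14) (interp 7 21 14))

/-- The stored multipliers are admissible, and the stored values belong to them. -/
structure Recorded (I : ARECInstance n) (N : ℕ) (z : ℕ → ℝ) (s : State) : Prop where
  le : s.realVar 5 ≤ s.realVar 4
  lower : z 0 ≤ s.realVar 5
  upper : s.realVar 4 ≤ z (N - 1)
  value : s.realVar 1 = I.bound (s.realVar 4) (s.realVar 5)
  spend : s.realVar 6 = I.spendOut (s.realVar 5)

theorem runs_record (hL : Loaded I N z s) (hz : I.IsGrid N z) {u v : ℝ}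
    (hu' : place z (s.natVar 20) (s.realVar 13) = u)
    (hv : IsPlace N (s.natVar 21) (s.realVar 14))
    (hv' : place z (s.natVar 21) (s.realVar 14) = v) (h9 : s.realVar 9 = I.bound u v)
    (hvu : v ≤ u) (hv0 : z 0 ≤ v) (hu1 : u ≤ z (N - 1)) :
    Runs record s fun t s' => t ≤ 60 ∧ Recorded I N z s' ∧ s'.realVar 1 = I.bound u v := by
  simp [record, hL.grid, hu', hv', h9, place_table hz.outLo hz.mono hL.outLo hv,
    place_table hz.outHi hz.mono hL.outHi hv]
  exact ⟨hvu, hv0, hu1, rfl, rfl⟩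

/-- Replaces the stored multipliers by better ones. -/
def consider : Program :=
  .seq evaluate <| .cond (.realLt (.var 1) (.var 9)) record .skip

theorem runs_consider (hL : Loaded I N z s) (hz : I.IsGrid N z) (hR : Recorded I N z s) {u v : ℝ}
    (hu : IsPlace N (s.natVar 20) (s.realVar 13))
    (hu' : place z (s.natVar 20) (s.realVar 13) = u)
    (hv : IsPlace N (s.natVar 21) (s.realVar 14))
    (hv' : place z (s.natVar 21) (s.realVar 14) = v)
    (hvu : v ≤ u) (hv0 : z 0 ≤ v) (hu1 : u ≤ z (N - 1)) :
    Runs consider s fun t s' => t ≤ 150 ∧ Recorded I N z s' ∧ s.realVar 1 ≤ s'.realVar 1 ∧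
      I.bound u v ≤ s'.realVar 1 := by
  rw [consider, runs_seq]
  refine (runs_evaluate hL hz hu hv).frame.mono ?_
  rintro t s₁ ⟨⟨ht, h9⟩, hf⟩
  rw [hu', hv'] at h9
  have e1 : s₁.realVar 1 = s.realVar 1 := hf.realVar 1 rfl
  have e20 : s₁.natVar 20 = s.natVar 20 := hf.natVar 20 rfl
  have e21 : s₁.natVar 21 = s.natVar 21 := hf.natVar 21 rfl
  have e13 : s₁.realVar 13 = s.realVar 13 := hf.realVar 13 rfl
  have e14 : s₁.realVar 14 = s.realVar 14 := hf.realVar 14 rfl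
  rw [runs_cond]
  simp only [Test.Holds, RealExpr.eval, h9, e1]
  constructor
  · intro h
    refine (runs_record (hL.frame hf (by decide)) hz (by rw [e20, e13, hu']) (by rwa [e21, e14])
      (by rw [e21, e14, hv']) h9 hvu hv0 hu1).mono ?_
    rintro t' s' ⟨ht', hR', h1⟩
    refine ⟨by simp; omega, hR', by rw [h1]; exact h.le, by rw [h1]⟩
  · intro h
    rw [runs_skip]
    have e4 : s₁.realVar 4 = s.realVar 4 := hf.realVar 4 rfl
    have e5 : s₁.realVar 5 = s.realVar 5 := hf.realVar 5 rfl
    have e6 : s₁.realVar 6 = s.realVar 6 := hf.realVar 6 rfl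
    refine ⟨by simp; omega, ⟨?_, ?_, ?_, ?_, ?_⟩, e1.ge, by rw [e1]; exact not_lt.1 h⟩
    · rw [e4, e5]; exact hR.le
    · rw [e5]; exact hR.lower
    · rw [e4]; exact hR.upper
    · rw [e1, e4, e5]; exact hR.value
    · rw [e6, e5]; exact hR.spend

/-- Stores the best pair of equal multipliers. -/
def searchDiag : Program :=
  .seq (.seq (.setReal 7 (.var 0)) <| .seq (.setNat 17 (.var 14)) (.setNat 18 (.var 15))) <|
  .seq (locate 9 10) <|
  .seq (.seq (.setNat 20 (.var 17)) <| .seq (.setReal 13 (.var 8)) <|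
    .seq (.setNat 21 (.var 17)) (.setReal 14 (.var 8))) <|
  .seq evaluate record

theorem runs_searchDiag (hL : Loaded I N z s) (hz : I.IsGrid N z) :
    Runs searchDiag s fun t s' => t ≤ (Nat.log 2 N + 1) * 40 + 300 ∧ Recorded I N z s' ∧
      ∀ u, z 0 ≤ u → u ≤ z (N - 1) → I.bound u u ≤ s'.realVar 1 := by
  have hle : s.natVar 14 ≤ s.natVar 15 := hL.argSum.le hz.mono I.spend_mono
  have hlt : s.natVar 15 < N := hL.argSum.2.1
  rw [searchDiag, runs_seq]
  refine (Runs.frame (Q := fun t s' => t ≤ 10 ∧ s'.natVar 17 = s.natVar 14 ∧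
    s'.natVar 18 = s.natVar 15 ∧ s'.realVar 7 = I.Γ) (by simp [hL.budget])).mono ?_
  rintro t₁ s₁ ⟨⟨ht₁, h17, h18, h7⟩, hf₁⟩
  have hL₁ := hL.frame hf₁ (by decide)
  rw [runs_seq]
  refine (runs_locate (N := N) h17 h18 h7 hle hlt.le).frame.mono ?_
  rintro t₂ s₂ ⟨⟨ht₂, hloc⟩, hf₂⟩
  have hL₂ := hL₁.frame hf₂ (by decide)
  obtain ⟨hp, hc⟩ := hloc.crossing (hz.inLo.add hz.outLo) (hz.inHi.add hz.outHi) hz.mono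
    hL₁.sumLo hL₁.sumHi hle hlt
  obtain ⟨h₀, h₁, hbest⟩ := hz.best_diag hL.argSum hc
  rw [runs_seq]
  refine (Runs.frame (Q := fun t s' => t ≤ 10 ∧ s'.natVar 20 = s₂.natVar 17 ∧
    s'.realVar 13 = s₂.realVar 8 ∧ s'.natVar 21 = s₂.natVar 17 ∧ s'.realVar 14 = s₂.realVar 8)
    (by simp)).mono ?_
  rintro t₃ s₃ ⟨⟨ht₃, h20, h13, h21, h14⟩, hf₃⟩
  have hL₃ := hL₂.frame hf₃ (by decide)
  rw [runs_seq]
  refine (runs_evaluate hL₃ hz (by rwa [h20, h13]) (by rwa [h21, h14])).frame.mono ?_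
  rintro t₄ s₄ ⟨⟨ht₄, h9⟩, hf₄⟩
  rw [h20, h13, h21, h14] at h9
  have e20 := (hf₄.natVar 20 rfl).trans h20
  have e13 := (hf₄.realVar 13 rfl).trans h13
  have e21 := (hf₄.natVar 21 rfl).trans h21
  have e14 := (hf₄.realVar 14 rfl).trans h14
  refine (runs_record (hL₃.frame hf₄ (by decide)) hz (by rw [e20, e13]) (by rwa [e21, e14])
    (by rw [e21, e14]) h9 le_rfl h₀ h₁).mono ?_
  rintro t₅ s₅ ⟨ht₅, hR, hv⟩
  refine ⟨by omega, hR, fun u hu hu' => ?_⟩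
  rw [hv]
  exact hbest u hu hu'

/-- For each grid point `u`, considers the best multiplier `v ≤ u`. -/
def searchOut : Program :=
  .forLoop 16 3 <|
    .seq (.seq (.setReal 7 (.minus (.plus (.var 0) (.read 5 (.var 16))) (.read 6 (.var 16)))) <|
      -- the maximizers, but at most the index of `u`: `a - (a - b)` is the minimum of `a` and `b`
      .seq (.setNat 17 (.minus (.var 12) (.minus (.var 12) (.var 16))))
        (.setNat 18 (.minus (.var 13) (.minus (.var 13) (.var 16))))) <|
    .seq (locate 7 8) <|
    .seq (.seq (.setNat 20 (.var 16)) <| .seq (.setReal 13 (.ofNat (.lit 0))) <|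
      .seq (.setNat 21 (.var 17)) (.setReal 14 (.var 8))) <|
    consider

theorem runs_searchOut (hL : Loaded I N z s) (hz : I.IsGrid N z) (hR : Recorded I N z s) :
    Runs searchOut s fun t s' => t ≤ N * ((Nat.log 2 N + 1) * 40 + 308) + 8 ∧
      Recorded I N z s' ∧ s.realVar 1 ≤ s'.realVar 1 ∧
      ∀ t < N, ∀ v, z 0 ≤ v → v ≤ z t → I.bound (z t) v ≤ s'.realVar 1 := by
  refine (Runs.forLoop (fun q s' => Recorded I N z s' ∧ s.realVar 1 ≤ s'.realVar 1 ∧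
    ∀ t < q, ∀ v, z 0 ≤ v → v ≤ z t → I.bound (z t) v ≤ s'.realVar 1)
    (B := (Nat.log 2 N + 1) * 40 + 300) rfl rfl (by decide) ?_ ?_).mono ?_
  · exact ⟨⟨hR.le, hR.lower, hR.upper, hR.value, hR.spend⟩, le_rfl, by simp⟩
  · rintro q s₀ hq h16 hf₀ ⟨hR₀, hge, hq₀⟩
    rw [hL.points] at hq
    have hL₀ := hL.frame hf₀ (by decide)
    have hle₀ : s₀.natVar 12 ≤ s₀.natVar 13 := hL₀.argOut.le hz.mono I.spendOut_mono
    have hle : min (s₀.natVar 12) q ≤ min (s₀.natVar 13) q := by omega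
    have hlt : min (s₀.natVar 13) q < N := by omega
    rw [runs_seq]
    refine (Runs.frame (Q := fun t s' => t ≤ 30 ∧ s'.natVar 17 = min (s₀.natVar 12) q ∧
      s'.natVar 18 = min (s₀.natVar 13) q ∧
      s'.realVar 7 = I.Γ + I.dualIn I.lo (z q) - I.dualIn I.hi (z q)) ?_).mono ?_
    · simp [hL₀.budget, h16, hL₀.inLo q hq, hL₀.inHi q hq]
      omega
    rintro t₁ s₁ ⟨⟨ht₁, h17, h18, h7⟩, hf₁⟩
    have hL₁ := hL₀.frame hf₁ (by decide)
    rw [runs_seq]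
    refine (runs_locate (N := N) h17 h18 h7 hle hlt.le).frame.mono ?_
    rintro t₂ s₂ ⟨⟨ht₂, hloc⟩, hf₂⟩
    have hL₂ := hL₁.frame hf₂ (by decide)
    obtain ⟨hp, hc⟩ := hloc.crossing hz.outLo hz.outHi hz.mono hL₁.outLo hL₁.outHi hle hlt
    obtain ⟨h₀, h₁, hbest⟩ := hz.best_out hL₀.argOut hq hc
    rw [runs_seq]
    refine (Runs.frame (Q := fun t s' => t ≤ 10 ∧ s'.natVar 20 = s₂.natVar 16 ∧
      s'.realVar 13 = 0 ∧ s'.natVar 21 = s₂.natVar 17 ∧ s'.realVar 14 = s₂.realVar 8)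
      (by simp)).mono ?_
    rintro t₃ s₃ ⟨⟨ht₃, h20, h13, h21, h14⟩, hf₃⟩
    rw [hf₂.natVar 16 rfl, hf₁.natVar 16 rfl, h16] at h20
    have e (v : ℕ) (h : v ∈ [1, 4, 5, 6]) : s₃.realVar v = s₀.realVar v := by
      simp only [List.mem_cons, List.not_mem_nil, or_false] at h
      rcases h with rfl | rfl | rfl | rfl <;>
        exact (hf₃.realVar _ rfl).trans ((hf₂.realVar _ rfl).trans (hf₁.realVar _ rfl))
    have hR₃ : Recorded I N z s₃ := by
      obtain ⟨g₁, g₂, g₃, g₄, g₅⟩ := hR₀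
      constructor <;> simpa [e]
    refine (runs_consider (hL₂.frame hf₃ (by decide)) hz hR₃ (u := z q)
      (by rw [h20, h13]; exact isPlace_zero hq) (by rw [h20, h13, place_zero])
      (by rwa [h21, h14]) (by rw [h21, h14]) h₁ h₀ (hz.mono _ _ (by omega) (by omega))).mono ?_
    rintro t₄ s₄ ⟨ht₄, hR₄, h₄, h₅⟩
    rw [e 1 (by simp)] at h₄
    refine ⟨by omega, ⟨hR₄.le, hR₄.lower, hR₄.upper, hR₄.value, hR₄.spend⟩, hge.trans h₄, ?_⟩
    intro t ht v hv₀ hv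
    rcases Nat.lt_succ_iff_lt_or_eq.1 ht with ht | rfl
    · exact (hq₀ t ht v hv₀ hv).trans h₄
    · exact (hbest v hv₀ hv).trans h₅
  · rintro t s' ⟨ht, ⟨hR', h₁, h₂⟩, -⟩
    rw [hL.points] at ht h₂
    exact ⟨by omega, hR', h₁, h₂⟩

/-- For each grid point `v`, considers the best multiplier `u ≥ v`. -/
def searchIn : Program :=
  .forLoop 16 3 <|
    .seq (.seq (.setReal 7 (.minus (.plus (.var 0) (.read 7 (.var 16))) (.read 8 (.var 16)))) <|
      -- the maximizers, but at least the index of `v`: `a + (b - a)` is the maximum of `a` and `b`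
      .seq (.setNat 17 (.plus (.var 10) (.minus (.var 16) (.var 10))))
        (.setNat 18 (.plus (.var 11) (.minus (.var 16) (.var 11))))) <|
    .seq (locate 5 6) <|
    .seq (.seq (.setNat 20 (.var 17)) <| .seq (.setReal 13 (.var 8)) <|
      .seq (.setNat 21 (.var 16)) (.setReal 14 (.ofNat (.lit 0)))) <|
    consider

theorem runs_searchIn (hL : Loaded I N z s) (hz : I.IsGrid N z) (hR : Recorded I N z s) :
    Runs searchIn s fun t s' => t ≤ N * ((Nat.log 2 N + 1) * 40 + 308) + 8 ∧
      Recorded I N z s' ∧ s.realVar 1 ≤ s'.realVar 1 ∧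
      ∀ t < N, ∀ u, z t ≤ u → u ≤ z (N - 1) → I.bound u (z t) ≤ s'.realVar 1 := by
  refine (Runs.forLoop (fun q s' => Recorded I N z s' ∧ s.realVar 1 ≤ s'.realVar 1 ∧
    ∀ t < q, ∀ u, z t ≤ u → u ≤ z (N - 1) → I.bound u (z t) ≤ s'.realVar 1)
    (B := (Nat.log 2 N + 1) * 40 + 300) rfl rfl (by decide) ?_ ?_).mono ?_
  · exact ⟨⟨hR.le, hR.lower, hR.upper, hR.value, hR.spend⟩, le_rfl, by simp⟩
  · rintro q s₀ hq h16 hf₀ ⟨hR₀, hge, hq₀⟩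
    rw [hL.points] at hq
    have hL₀ := hL.frame hf₀ (by decide)
    have hle₀ : s₀.natVar 10 ≤ s₀.natVar 11 := hL₀.argIn.le hz.mono I.spendIn_mono
    have hlt₀ : s₀.natVar 11 < N := hL₀.argIn.2.1
    have hle : max (s₀.natVar 10) q ≤ max (s₀.natVar 11) q := by omega
    have hlt : max (s₀.natVar 11) q < N := by omega
    rw [runs_seq]
    refine (Runs.frame (Q := fun t s' => t ≤ 30 ∧ s'.natVar 17 = max (s₀.natVar 10) q ∧
      s'.natVar 18 = max (s₀.natVar 11) q ∧
      s'.realVar 7 = I.Γ + I.dualOut I.lo (z q) - I.dualOut I.hi (z q)) ?_).mono ?_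
    · simp [hL₀.budget, h16, hL₀.outLo q hq, hL₀.outHi q hq]
      omega
    rintro t₁ s₁ ⟨⟨ht₁, h17, h18, h7⟩, hf₁⟩
    have hL₁ := hL₀.frame hf₁ (by decide)
    rw [runs_seq]
    refine (runs_locate (N := N) h17 h18 h7 hle hlt.le).frame.mono ?_
    rintro t₂ s₂ ⟨⟨ht₂, hloc⟩, hf₂⟩
    have hL₂ := hL₁.frame hf₂ (by decide)
    obtain ⟨hp, hc⟩ := hloc.crossing hz.inLo hz.inHi hz.mono hL₁.inLo hL₁.inHi hle hlt
    obtain ⟨h₀, h₁, hbest⟩ := hz.best_in hL₀.argIn hq hc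
    rw [runs_seq]
    refine (Runs.frame (Q := fun t s' => t ≤ 10 ∧ s'.natVar 20 = s₂.natVar 17 ∧
      s'.realVar 13 = s₂.realVar 8 ∧ s'.natVar 21 = s₂.natVar 16 ∧ s'.realVar 14 = 0)
      (by simp)).mono ?_
    rintro t₃ s₃ ⟨⟨ht₃, h20, h13, h21, h14⟩, hf₃⟩
    rw [hf₂.natVar 16 rfl, hf₁.natVar 16 rfl, h16] at h21
    have e (v : ℕ) (h : v ∈ [1, 4, 5, 6]) : s₃.realVar v = s₀.realVar v := by
      simp only [List.mem_cons, List.not_mem_nil, or_false] at h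
      rcases h with rfl | rfl | rfl | rfl <;>
        exact (hf₃.realVar _ rfl).trans ((hf₂.realVar _ rfl).trans (hf₁.realVar _ rfl))
    have hR₃ : Recorded I N z s₃ := by
      obtain ⟨g₁, g₂, g₃, g₄, g₅⟩ := hR₀
      constructor <;> simpa [e]
    refine (runs_consider (hL₂.frame hf₃ (by decide)) hz hR₃ (v := z q)
      (by rwa [h20, h13]) (by rw [h20, h13]) (by rw [h21, h14]; exact isPlace_zero hq)
      (by rw [h21, h14, place_zero]) h₀ (hz.mono _ _ (by omega) (by omega)) h₁).mono ?_
    rintro t₄ s₄ ⟨ht₄, hR₄, h₄, h₅⟩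
    rw [e 1 (by simp)] at h₄
    refine ⟨by omega, ⟨hR₄.le, hR₄.lower, hR₄.upper, hR₄.value, hR₄.spend⟩, hge.trans h₄, ?_⟩
    intro t ht u hu hu₁
    rcases Nat.lt_succ_iff_lt_or_eq.1 ht with ht | rfl
    · exact (hq₀ t ht u hu hu₁).trans h₄
    · exact (hbest u hu hu₁).trans h₅
  · rintro t s' ⟨ht, ⟨hR', h₁, h₂⟩, -⟩
    rw [hL.points] at ht h₂
    exact ⟨by omega, hR', h₁, h₂⟩

end

end RealRAM

/-! ### Levels and scenario -/

namespace RealRAM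

section
variable {n : ℕ} {I : ARECInstance n} {N : ℕ} {z : ℕ → ℝ} {s : State}

/-- Lowers the stored multipliers to levels that respect the budget, in the real variables `2` and `3`:
the level outside `X` may use the whole budget, the level of `X` what is left of it. -/
def findLevels : Program :=
  .seq (.seq (.setReal 7 (.var 0)) <| .seq (.setNat 17 (.lit 0))
    (.setNat 18 (.minus (.var 3) (.lit 1)))) <|
  .seq (locate 7 8) <|
  .seq (.seq (.setReal 3 (interp 3 17 8)) <|
    .seq (.cond (.realLt (.var 5) (.var 3)) (.setReal 3 (.var 5)) .skip) <|
    .seq (.setReal 7 (.minus (.var 0) (.var 6))) <|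
    .seq (.cond (.realLt (.var 7) (.ofNat (.lit 0))) (.setReal 7 (.ofNat (.lit 0))) .skip) <|
    .seq (.setNat 17 (.lit 0)) (.setNat 18 (.minus (.var 3) (.lit 1)))) <|
  .seq (locate 5 6) <|
  .seq (.setReal 2 (interp 3 17 8)) <|
  .cond (.realLt (.var 4) (.var 2)) (.setReal 2 (.var 4)) .skip

theorem spendOut_lower (hz : I.IsGrid N z) : I.spendOut (z 0) = 0 := by
  unfold ARECInstance.spendOut ARECInstance.dualOut bend
  rw [Finset.sum_eq_zero, Finset.sum_eq_zero]
  · ring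
  · intro i _
    exact max_eq_left (by linarith [hz.le_lo i])
  · intro i _
    exact max_eq_left (by linarith [hz.le_lo i, I.lo_le_hi i])

theorem spendIn_lower (hz : I.IsGrid N z) : I.spendIn (z 0) = 0 := by
  unfold ARECInstance.spendIn ARECInstance.dualIn bend
  rw [Finset.sum_eq_zero, Finset.sum_eq_zero]
  · ring
  · intro i _
    exact max_eq_left (by linarith [hz.le_lo i])
  · intro i _
    exact max_eq_left (by linarith [hz.le_lo i, I.lo_le_hi i])

theorem runs_findLevels (hL : Loaded I N z s) (hz : I.IsGrid N z) (hR : Recorded I N z s) :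
    Runs findLevels s fun t s' => t ≤ (Nat.log 2 N + 1) * 80 + 250 ∧
      s'.realVar 2 ≤ s.realVar 4 ∧ s'.realVar 3 ≤ s.realVar 5 ∧
      I.spendIn (s'.realVar 2) + I.spendOut (s'.realVar 3) =
        min I.Γ (I.spendIn (s.realVar 4) + I.spendOut (s.realVar 5)) := by
  have hN := hz.two_le
  rw [findLevels, runs_seq]
  refine (Runs.frame (Q := fun t s' => t ≤ 10 ∧ s'.natVar 17 = 0 ∧ s'.natVar 18 = N - 1 ∧
    s'.realVar 7 = I.Γ) (by simp [hL.budget, hL.points])).mono ?_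
  rintro t₁ s₁ ⟨⟨ht₁, h17, h18, h7⟩, hf₁⟩
  have hL₁ := hL.frame hf₁ (by decide)
  rw [runs_seq]
  refine (runs_locate (N := N) h17 h18 h7 (Nat.zero_le _) (Nat.sub_le _ _)).frame.mono ?_
  rintro t₂ s₂ ⟨⟨ht₂, hloc⟩, hf₂⟩
  have hL₂ := hL₁.frame hf₂ (by decide)
  obtain ⟨hp, hc⟩ := hloc.crossing hz.outLo hz.outHi hz.mono hL₁.outLo hL₁.outHi (Nat.zero_le _)
    (by omega)
  have e (v : ℕ) (h : v ∈ [4, 5, 6]) : s₂.realVar v = s.realVar v := by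
    simp only [List.mem_cons, List.not_mem_nil, or_false] at h
    rcases h with rfl | rfl | rfl <;> exact (hf₂.realVar _ rfl).trans (hf₁.realVar _ rfl)
  have hM := Crossing.map_min I.spendOut_mono (v := s.realVar 5) I.Γ_nonneg
    (spendOut_lower hz) (hR.le.trans hR.upper) hc
  rw [runs_seq]
  refine (Runs.frame (Q := fun t s' => t ≤ 80 ∧ s'.natVar 17 = 0 ∧ s'.natVar 18 = N - 1 ∧
    s'.realVar 7 = max 0 (I.Γ - I.spendOut (s.realVar 5)) ∧
    s'.realVar 3 = min (s.realVar 5) (place z (s₂.natVar 17) (s₂.realVar 8))) ?_).mono ?_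
  · simp [hL₂.grid, hL₂.budget, hL₂.points, e, hR.spend]
    exact ⟨fun h => ⟨fun h' => ⟨h'.le, h.le⟩, fun h' => ⟨h', h.le⟩⟩,
      fun h => ⟨fun h' => ⟨h'.le, h⟩, fun h' => ⟨h', h⟩⟩⟩
  rintro t₃ s₃ ⟨⟨ht₃, h17', h18', h7', h3⟩, hf₃⟩
  have hL₃ := hL₂.frame hf₃ (by decide)
  rw [runs_seq]
  refine (runs_locate (N := N) h17' h18' h7' (Nat.zero_le _) (Nat.sub_le _ _)).frame.mono ?_
  rintro t₄ s₄ ⟨⟨ht₄, hloc'⟩, hf₄⟩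
  obtain ⟨hp', hc'⟩ := hloc'.crossing hz.inLo hz.inHi hz.mono hL₃.inLo hL₃.inHi (Nat.zero_le _)
    (by omega)
  have hI := Crossing.map_min I.spendIn_mono (v := s.realVar 4) (le_max_left _ _)
    (spendIn_lower hz) hR.upper hc'
  have e4 : s₄.realVar 4 = s.realVar 4 :=
    (hf₄.realVar 4 rfl).trans ((hf₃.realVar 4 rfl).trans (e 4 (by simp)))
  have e3 := (hf₄.realVar 3 rfl).trans h3
  have eg : s₄.realArr 3 = z := (hf₄.realArr 3 rfl).trans hL₃.grid
  refine Runs.mono (Q := fun t s' => t ≤ 30 ∧ s'.realVar 3 = s₄.realVar 3 ∧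
    s'.realVar 2 = min (s.realVar 4) (place z (s₄.natVar 17) (s₄.realVar 8))) ?_ ?_
  · simp [eg, e4]
    exact fun h => h.le
  rintro t₅ s₅ ⟨ht₅, h3', h2⟩
  rw [e3] at h3'
  rw [h2, h3', hM, hI]
  refine ⟨by omega, min_le_left _ _, min_le_left _ _, ?_⟩
  rcases le_total (I.spendOut (s.realVar 5)) I.Γ with h | h
  · rw [min_eq_left h, max_eq_right (by linarith), ← min_add_add_right, sub_add_cancel, min_comm]
  · have h₁ : 0 ≤ I.spendIn (s.realVar 4) := by
      rw [← spendIn_lower hz]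
      exact I.spendIn_mono (hR.lower.trans hR.le)
    rw [min_eq_right h, max_eq_left (by linarith), min_eq_right h₁, min_eq_left (by linarith),
      zero_add]

/-- Raises the items to the levels. -/
def writeScenario : Program :=
  .forLoop 5 0 <|
    .seq (.cond (.natLt (.lit 0) (.read 0 (.var 5))) (.setReal 9 (.var 2)) (.setReal 9 (.var 3))) <|
    .seq (.setReal 10 (.plus (.read 0 (.var 5)) (.read 1 (.var 5)))) <|
    .seq (.cond (.realLt (.var 10) (.var 9)) (.setReal 9 (.var 10)) .skip) <|
    .seq (.cond (.realLt (.var 9) (.read 0 (.var 5))) (.setReal 9 (.read 0 (.var 5))) .skip) <|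
    .writeReal 2 (.var 5) (.var 9)

theorem runs_writeScenario (hL : Loaded I N z s) :
    Runs writeScenario s fun t s' => t ≤ n * 60 + 10 ∧
      I.IsCompatible (s.realVar 2) (s.realVar 3) (s'.scenario n) := by
  refine (Runs.forLoop (fun q s' => ∀ i : Fin n, i < q → s'.realArr 2 i =
    max (I.lo i) (min (I.hi i) (if i ∈ I.X then s.realVar 2 else s.realVar 3))) (B := 50)
    rfl rfl (by decide) (by simp) ?_).mono ?_
  · intro q s₀ hq h5 hf hJ
    rw [hL.items] at hq
    have hL₀ := hL.frame hf (by decide)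
    have e2 : s₀.realVar 2 = s.realVar 2 := hf.realVar 2 rfl
    have e3 : s₀.realVar 3 = s.realVar 3 := hf.realVar 3 rfl
    have elo := hL₀.lo ⟨q, hq⟩
    have ed := hL₀.dev ⟨q, hq⟩
    have eX := hL₀.mark ⟨q, hq⟩
    simp only at elo ed eX
    obtain ⟨l, hl⟩ : ∃ l, (if (⟨q, hq⟩ : Fin n) ∈ I.X then s.realVar 2 else s.realVar 3) = l :=
      ⟨_, rfl⟩
    rw [runs_seq]
    refine (Runs.frame (Q := fun t s' => t ≤ 8 ∧ s'.realVar 9 = l) ?_).mono ?_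
    · by_cases hX : (⟨q, hq⟩ : Fin n) ∈ I.X <;>
        simp [h5, eX, e2, e3, ARECInstance.mark, ← hl, hX]
    rintro t₁ s₁ ⟨⟨ht₁, h9⟩, hf₁⟩
    have h5₁ : s₁.natVar 5 = q := (hf₁.natVar 5 rfl).trans h5
    have elo₁ : s₁.realArr 0 q = I.lo ⟨q, hq⟩ := by rw [hf₁.realArr 0 rfl, elo]
    have ed₁ : s₁.realArr 1 q = I.d ⟨q, hq⟩ := by rw [hf₁.realArr 1 rfl, ed]
    have hfin (x : ℝ) (hx : x = max (I.lo ⟨q, hq⟩) (min (I.hi ⟨q, hq⟩) l)) (i : Fin n)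
        (hi : i.1 ≤ q) : Function.update (s₁.realArr 2) q x i =
        max (I.lo i) (min (I.hi i) (if i ∈ I.X then s.realVar 2 else s.realVar 3)) := by
      rcases Nat.lt_or_eq_of_le hi with hi | hi
      · rw [Function.update_of_ne hi.ne, hf₁.realArr 2 rfl]
        exact hJ i hi
      · subst hi
        rw [Function.update_self, hx, ← hl]
    simp [h5₁, h9, elo₁, ed₁]
    have hd := I.d_nonneg ⟨q, hq⟩
    have ehi : I.lo ⟨q, hq⟩ + I.d ⟨q, hq⟩ = I.hi ⟨q, hq⟩ := rfl
    have hlh := I.lo_le_hi ⟨q, hq⟩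
    rw [ehi]
    refine ⟨fun h => ⟨fun h' => by linarith, fun _ => ⟨by omega, hfin _ ?_⟩⟩,
      fun h => ⟨fun h' => ⟨by omega, hfin _ ?_⟩, fun h' => ⟨by omega, hfin _ ?_⟩⟩⟩
    · rw [min_eq_left h.le, max_eq_right hlh]
    · rw [min_eq_right h, max_eq_left h'.le]
    · rw [min_eq_right h, max_eq_right h']
  · rintro t s' ⟨ht, hJ, -⟩
    rw [hL.items] at ht hJ
    refine ⟨by omega, fun i hi => ?_, fun i hi => ?_⟩
    · rw [RealRAM.State.scenario, hJ i i.2, if_pos hi]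
    · rw [RealRAM.State.scenario, hJ i i.2, if_neg hi]

end

/-- The program that solves the problem. After sorting, the real array `3` holds the grid, `5`, …, `10` hold
the tables, and the natural variables `10`, …, `15` their maximizers; the real variables `1`, `4`, `5` hold
the best bound found so far and its multipliers. -/
def solve : Program :=
  .seq load <| .seq searchDiag <| .seq searchOut <| .seq searchIn <| .seq findLevels writeScenario

/-- The factor `3000` is a generous bound for the sum of the constants of the single parts. -/
theorem runs_solve {n : ℕ} (I : ARECInstance n) :
    Runs solve I.input fun t s => t ≤ 3000 * (2 * n + 1) * (Nat.log 2 (2 * n) + 1) ∧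
      I.IsWorstScenario (s.scenario n) ∧ s.realVar 1 = I.recoveryCost (s.scenario n) ∧
      I.IsCompatible (s.realVar 2) (s.realVar 3) (s.scenario n) := by
  rw [solve, runs_seq]
  refine (runs_load I).mono ?_
  rintro t₁ s₁ ⟨ht₁, z, hz, hL₁⟩
  rw [runs_seq]
  refine (runs_searchDiag hL₁ hz).frame.mono ?_
  rintro t₂ s₂ ⟨⟨ht₂, hR₂, hdiag⟩, hf₂⟩
  have hL₂ := hL₁.frame hf₂ (by decide)
  rw [runs_seq]
  refine (runs_searchOut hL₂ hz hR₂).frame.mono ?_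
  rintro t₃ s₃ ⟨⟨ht₃, hR₃, h₃, hout⟩, hf₃⟩
  have hL₃ := hL₂.frame hf₃ (by decide)
  rw [runs_seq]
  refine (runs_searchIn hL₃ hz hR₃).frame.mono ?_
  rintro t₄ s₄ ⟨⟨ht₄, hR₄, h₄, hin⟩, hf₄⟩
  have hL₄ := hL₃.frame hf₄ (by decide)
  rw [runs_seq]
  refine (runs_findLevels hL₄ hz hR₄).frame.mono ?_
  rintro t₅ s₅ ⟨⟨ht₅, hle₁, hle₂, hspend⟩, hf₅⟩
  have hL₅ := hL₄.frame hf₅ (by decide)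
  refine (runs_writeScenario hL₅).frame.mono ?_
  rintro t₆ s₆ ⟨⟨ht₆, hcomp⟩, hf₆⟩
  have hlo := (hR₄.lower.trans hR₄.le).trans hR₄.upper
  have hopt (u v : ℝ) (h₁ : v ≤ u) (h₂ : z 0 ≤ v) (h₃' : u ≤ z (n + n - 1)) :
      I.bound u v ≤ I.bound (s₄.realVar 4) (s₄.realVar 5) := by
    rw [← hR₄.value]
    refine hz.bound_le ?_ hin ?_ h₁ h₂ h₃'
    · exact fun t ht v hv hv' => (hout t ht v hv hv').trans h₄
    · exact fun u hu hu' => (hdiag u hu hu').trans (h₃.trans h₄)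
  obtain ⟨hworst, hval⟩ := I.isWorstScenario_of_levels hlo hz.le_lo hz.hi_le hR₄.le hle₁ hle₂
    hspend hopt hcomp
  refine ⟨?_, hworst, ?_, ?_⟩
  · have hn := I.n_pos
    rw [← two_mul] at ht₁ ht₂ ht₃ ht₄ ht₅
    obtain ⟨l, hl⟩ : ∃ l, Nat.log 2 (2 * n) + 1 = l := ⟨_, rfl⟩
    have hl1 : 1 ≤ l := by omega
    rw [hl] at ht₁ ht₂ ht₃ ht₄ ht₅ ⊢
    have hnl : n ≤ l * n := Nat.le_mul_of_pos_left n hl1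
    ring_nf at ht₁ ht₂ ht₃ ht₄ ht₅ ht₆ ⊢
    omega
  · rw [hf₆.realVar 1 rfl, hf₅.realVar 1 rfl, hR₄.value, hval]
  · rw [hf₆.realVar 2 rfl, hf₆.realVar 3 rfl]
    exact hcomp

end RealRAM

theorem isBigO_linearithmic :
    (fun n : ℕ => ((3000 * (2 * n + 1) * (Nat.log 2 (2 * n) + 1) : ℕ) : ℝ)) =O[atTop]
      fun n : ℕ => (n : ℝ) * Real.log n := by
  refine IsBigO.of_bound (3000 * 3 * (3 / Real.log 2)) ?_
  filter_upwards [eventually_ge_atTop 2] with n hn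
  have h2 : 0 < Real.log 2 := Real.log_pos (by norm_num)
  have hn' : (2 : ℝ) ≤ n := by exact_mod_cast hn
  have hlog : Real.log 2 ≤ Real.log n := Real.log_le_log (by norm_num) hn'
  have h₁ : ((Nat.log 2 (2 * n) : ℕ) : ℝ) + 1 ≤ 3 / Real.log 2 * Real.log n := by
    have h₃ : Nat.log 2 (2 * n) = Nat.log 2 n + 1 := by
      rw [mul_comm, Nat.log_mul_base (by norm_num) (by omega)]
    have h₄ : ((Nat.log 2 n : ℕ) : ℝ) ≤ Real.log n / Real.log 2 := by
      have := Real.natLog_le_logb n 2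
      rwa [Real.logb] at this
    have h₅ : 1 ≤ Real.log n / Real.log 2 := (one_le_div h2).2 hlog
    rw [h₃]
    push_cast
    have : 3 / Real.log 2 * Real.log n = 3 * (Real.log n / Real.log 2) := by ring
    linarith
  have h₂ : 0 ≤ Real.log n := h2.le.trans hlog
  rw [Real.norm_of_nonneg (Nat.cast_nonneg _), Real.norm_of_nonneg (by positivity)]
  push_cast
  calc 3000 * (2 * (n : ℝ) + 1) * ((Nat.log 2 (2 * n) : ℕ) + 1)
      ≤ 3000 * (3 * n) * (3 / Real.log 2 * Real.log n) := by
        gcongr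
        linarith
    _ = _ := by ring

theorem mainTheorem4 :
    ∃ (P : RealRAM.Program) (T : ℕ → ℕ),
      (fun n : ℕ => (T n : ℝ)) =O[atTop] (fun n : ℕ => (n : ℝ) * Real.log n) ∧
      ∀ (n : ℕ) (I : ARECInstance n), ∃ (t : ℕ) (s : RealRAM.State),
        RealRAM.Exec P I.input t s ∧ t ≤ T n ∧
        I.IsWorstScenario (s.scenario n) ∧
        s.realVar 1 = I.recoveryCost (s.scenario n) ∧
        I.IsCompatible (s.realVar 2) (s.realVar 3) (s.scenario n) :=
  ⟨RealRAM.solve, _, isBigO_linearithmic, fun _ I => RealRAM.runs_solve I⟩
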